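/- Setting. All objects are smooth. A hyperbolic Monge--Ampère system $\mathcal I$ on a 5-manifold $M$ is an exterior differential system that is locally generated algebraically by a contact form $\theta$ (so $\theta\wedge d\theta\wedge d\theta\ne0$), the 2-form $\Theta=d\theta$ and a further 2-form $\Psi$, such that the quadratic equation $(\lambda\Theta+\mu\Psi)\wedge(\lambda\Theta+\mu\Psi)\equiv0 \bmod \theta$ has two distinct real roots $(\lambda:\mu)$ at every point. Let $(M_1,\mathcal I_1)$, $(M_2,\mathcal I_2)$ be two such systems. A Bäcklund transformation between them is a 6-dimensional submanifold $\mathcal B\subset M_1\times M_2$ whose projections $\pi_i:\mathcal B\to M_i$ are submersions and such that, for suitable local generators $\theta_i,\Theta_i=d\theta_i,\Psi_i$ of $\mathcal I_i$, one has on $\mathcal B$ (after pullback) $\{\Psi_1,\Psi_2\}\equiv\{\Theta_1,\Theta_2\}\bmod\{\theta_1,\theta_2\}$. It is homogeneous if the group of diffeomorphisms of $\mathcal B$ that preserve each of the ideals on $\mathcal B$ generated by $\pi_1^*\mathcal I_1$ and by $\pi_2^*\mathcal I_2$ acts transitively on $\mathcal B$. A coframing $(\theta_1,\theta_2,\omega^1,\omega^2,\omega^3,\omega^4)$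 on an open set $U\subset\mathcal B$ is called 0-adapted if $\theta_i$ spans the pullback of the contact line of $\mathcal I_i$ ($i=1,2$), the ideal generated on $U$ by $\pi_1^*\mathcal I_1$ and $\pi_2^*\mathcal I_2$ is $\{\theta_1,\theta_2,\omega^1\wedge\omega^2,\omega^3\wedge\omega^4\}$, and $$d\theta_1\equiv A_1\,\omega^1\wedge\omega^2+\omega^3\wedge\omega^4 \bmod\theta_1,\qquad d\theta_2\equiv \omega^1\wedge\omega^2+A_2\,\omega^3\wedge\omega^4\bmod\theta_2$$ for nonvanishing functions $A_1,A_2$ with $A_1A_2\neq1$. Expand the $d\omega^i$ in the basis of 2-forms given by the wedge products of the coframing. Let $B_i$ be the coefficient of $\theta_1\wedge\theta_2$ in $d\omega^i$ ($i=1,\dots,4$), let $C_1,C_2$ be the coefficients of $\omega^3\wedge\omega^4$ in $d\omega^1,d\omega^2$, and let $C_3,C_4$ be the coefficients of $\omega^1\wedge\omega^2$ in $d\omega^3,d\omega^4$. If the vectors $[C_1\ C_2]$ and $[C_3\ C_4]$ are both nonzero, a 0-adapted coframing is called 1-adapted if $C_1=C_3=0$ and $C_2=C_4=1$. Lemma.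 Let $\mathcal B$ be a Bäcklund transformation between hyperbolic Monge--Ampère systems, with a 1-adapted coframing on an open set $U\subset\mathcal B$. Then for every open $V\subset U$, $[B_1\ B_2]$ vanishes identically on $V$ if and only if $[B_3\ B_4]$ vanishes identically on $V$. If moreover $\mathcal B$ is homogeneous, then either $[B_1\ B_2]$ and $[B_3\ B_4]$ are both zero at every point of $U$, or they are both nonzero at every point of $U$. -/

import Mathlib

open scoped Manifold ContDiff Topology

noncomputable section

namespace Backlund

/-! ### Exterior algebra of one (tangent) space -/

section Pointwise

variable {V : Type*} [AddCommGroup V] [Module ℝ V] [TopologicalSpace V]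

/-- The wedge product `a ∧ b` of two covectors (alternating `1`-forms), normalised by
`(a ∧ b) (v, w) = a v * b w - a w * b v`; see `wedge_apply`. -/
def wedge (a b : V [⋀^Fin 1]→L[ℝ] ℝ) : V [⋀^Fin 2]→L[ℝ] ℝ :=
  ContinuousMultilinearMap.alternatization
    ((ContinuousMultilinearMap.mkPiAlgebra ℝ (Fin 2) ℝ).compContinuousLinearMap
      ![(ContinuousAlternatingMap.ofSubsingleton ℝ V ℝ (0 : Fin 1)).symm a,
        (ContinuousAlternatingMap.ofSubsingleton ℝ V ℝ (0 : Fin 1)).symm b])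

theorem wedge_apply (a b : V [⋀^Fin 1]→L[ℝ] ℝ) (v : Fin 2 → V) :
    wedge a b v = a ![v 0] * b ![v 1] - a ![v 1] * b ![v 0] := by
  have h : ∀ (c : V [⋀^Fin 1]→L[ℝ] ℝ) (w : V),
      (ContinuousAlternatingMap.ofSubsingleton ℝ V ℝ (0 : Fin 1)).symm c w = c ![w] := by
    intro c w
    rw [ContinuousAlternatingMap.ofSubsingleton_symm_apply_apply]
    congr 1
    ext i
    fin_cases i
    rfl
  have hu : (Finset.univ : Finset (Equiv.Perm (Fin 2))) = {1, Equiv.swap 0 1} := by decide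
  have hn : (1 : Equiv.Perm (Fin 2)) ≠ Equiv.swap 0 1 := by decide
  rw [wedge, ContinuousMultilinearMap.alternatization_apply_apply, hu, Finset.sum_pair hn]
  simp [Fin.prod_univ_two, h]
  ring

/-- The value on `v` of the `5`-form `θ ∧ Φ ∧ Φ'`, where `θ` has degree `1` and `Φ`, `Φ'` have
degree `2`. -/
def wedge₁₂₂ (θ : V [⋀^Fin 1]→L[ℝ] ℝ) (Φ Φ' : V [⋀^Fin 2]→L[ℝ] ℝ) (v : Fin 5 → V) : ℝ :=
  (1 / 4 : ℝ) * ∑ σ : Equiv.Perm (Fin 5), ((Equiv.Perm.sign σ : ℤ) : ℝ) *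
    (θ ![v (σ 0)] * Φ ![v (σ 1), v (σ 2)] * Φ' ![v (σ 3), v (σ 4)])

variable (V) in
/-- The parts of degree `1` and of degree `2` of an ideal in the exterior algebra of the dual
of `V`. All ideals below are generated in degrees `1` and `2`, so they are determined by these. -/
@[ext]
structure FormIdeal where
  /-- the covectors in the ideal -/
  deg1 : Submodule ℝ (V [⋀^Fin 1]→L[ℝ] ℝ)
  /-- the `2`-forms in the ideal -/
  deg2 : Submodule ℝ (V [⋀^Fin 2]→L[ℝ] ℝ)

/-- The ideal generated algebraically by a set of covectors and a set of `2`-forms. -/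
def FormIdeal.gen (S₁ : Set (V [⋀^Fin 1]→L[ℝ] ℝ)) (S₂ : Set (V [⋀^Fin 2]→L[ℝ] ℝ)) :
    FormIdeal V where
  deg1 := Submodule.span ℝ S₁
  deg2 := Submodule.span ℝ ({Φ | ∃ a ∈ S₁, ∃ b, Φ = wedge a b} ∪ S₂)

/-- The ideal generated by two ideals, that is, their sum. -/
def FormIdeal.sup (P Q : FormIdeal V) : FormIdeal V where
  deg1 := P.deg1 ⊔ Q.deg1
  deg2 := P.deg2 ⊔ Q.deg2

end Pointwise

/-! ### Differential forms on manifolds -/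

section Forms

/-- `k`-forms on the `n`-dimensional manifold `M` (without any regularity). -/
abbrev Form (n : ℕ) (M : Type*) [TopologicalSpace M] [ChartedSpace (EuclideanSpace ℝ (Fin n)) M]
    (k : ℕ) : Type _ :=
  ∀ x : M, TangentSpace (𝓡 n) x [⋀^Fin k]→L[ℝ] ℝ

/-- An assignment to every point of an ideal in the exterior algebra of the cotangent space. -/
abbrev IdealField (n : ℕ) (M : Type*) [TopologicalSpace M]
    [ChartedSpace (EuclideanSpace ℝ (Fin n)) M] : Type _ :=
  ∀ x : M, FormIdeal (TangentSpace (𝓡 n) x)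

variable {m n k : ℕ}
  {M : Type*} [TopologicalSpace M] [ChartedSpace (EuclideanSpace ℝ (Fin n)) M]
  {N : Type*} [TopologicalSpace N] [ChartedSpace (EuclideanSpace ℝ (Fin m)) N]

/-- The coordinate expression of a form in the preferred chart at `c`: its pullback by the inverse
of the chart. It is meaningful on the target of the chart. -/
def Form.coord (α : Form n M k) (c : M) (y : EuclideanSpace ℝ (Fin n)) :
    EuclideanSpace ℝ (Fin n) [⋀^Fin k]→L[ℝ] ℝ :=
  (α ((extChartAt (𝓡 n) c).symm y)).compContinuousLinearMap
    (mfderiv 𝓘(ℝ, EuclideanSpace ℝ (Fin n)) (𝓡 n) (extChartAt (𝓡 n) c).symm y)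

/-- The form `α` is smooth at every point of `U` (read in the preferred chart at that point). -/
def Form.SmoothOn (α : Form n M k) (U : Set M) : Prop :=
  ∀ c ∈ U, ContDiffAt ℝ ∞ (α.coord c) (extChartAt (𝓡 n) c c)

/-- The exterior derivative, computed at each point in the preferred chart at that point. -/
def Form.d (α : Form n M k) : Form n M (k + 1) := fun x =>
  (extDeriv (α.coord x) (extChartAt (𝓡 n) x x)).compContinuousLinearMap
    (mfderiv (𝓡 n) 𝓘(ℝ, EuclideanSpace ℝ (Fin n)) (extChartAt (𝓡 n) x) x)

/-- The pullback `f^* α` of a form. -/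
def Form.pullback (f : M → N) (α : Form m N k) : Form n M k := fun x =>
  (α (f x)).compContinuousLinearMap (mfderiv (𝓡 n) (𝓡 m) f x)

/-- The ideal on `M` generated by the pullbacks by `f` of the elements of an ideal on `N`. -/
def IdealField.pullback (f : M → N) (P : IdealField m N) : IdealField n M := fun x =>
  FormIdeal.gen
    ((fun a : TangentSpace (𝓡 m) (f x) [⋀^Fin 1]→L[ℝ] ℝ =>
      a.compContinuousLinearMap (mfderiv (𝓡 n) (𝓡 m) f x)) '' (P (f x)).deg1)
    ((fun Φ : TangentSpace (𝓡 m) (f x) [⋀^Fin 2]→L[ℝ] ℝ =>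
      Φ.compContinuousLinearMap (mfderiv (𝓡 n) (𝓡 m) f x)) '' (P (f x)).deg2)

end Forms

/-! ### Hyperbolic Monge-Ampère systems and Bäcklund transformations -/

section Systems

variable {M : Type*} [TopologicalSpace M] [ChartedSpace (EuclideanSpace ℝ (Fin 5)) M]

/-- On the open set `U`, the field of ideals `P` is generated by the contact form `θ`, by
`Θ = dθ` and by `Ψ`, and it is hyperbolic: the quadratic equation
`(s Θ + t Ψ) ∧ (s Θ + t Ψ) ≡ 0 mod θ` (that is, `θ ∧ (s Θ + t Ψ) ∧ (s Θ + t Ψ) = 0`), which is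
nontrivial since `θ ∧ Θ ∧ Θ ≠ 0`, has two distinct real roots `(s : t)`. -/
structure IsMongeAmpereGenerator (P : IdealField 5 M) (U : Set M)
    (θ : Form 5 M 1) (Ψ : Form 5 M 2) : Prop where
  isOpen : IsOpen U
  smooth_theta : θ.SmoothOn U
  smooth_psi : Ψ.SmoothOn U
  contact : ∀ x ∈ U, ∃ v, wedge₁₂₂ (θ x) (θ.d x) (θ.d x) v ≠ 0
  hyperbolic : ∀ x ∈ U, ∃ s t s' t' : ℝ, s * t' - s' * t ≠ 0 ∧
    (∀ v, wedge₁₂₂ (θ x) (s • θ.d x + t • Ψ x) (s • θ.d x + t • Ψ x) v = 0) ∧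
    (∀ v, wedge₁₂₂ (θ x) (s' • θ.d x + t' • Ψ x) (s' • θ.d x + t' • Ψ x) v = 0)
  generates : ∀ x ∈ U, P x = FormIdeal.gen {θ x} {θ.d x, Ψ x}

/-- A hyperbolic Monge-Ampère system on a `5`-manifold. (Such an ideal is automatically
differentially closed: modulo a contact form `θ` and `dθ`, every `3`-form vanishes.) -/
def IsHyperbolicMongeAmpere (P : IdealField 5 M) : Prop :=
  ∀ x : M, ∃ U θ Ψ, x ∈ U ∧ IsMongeAmpereGenerator P U θ Ψ

variable {M₁ : Type*} [TopologicalSpace M₁] [ChartedSpace (EuclideanSpace ℝ (Fin 5)) M₁]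
  {M₂ : Type*} [TopologicalSpace M₂] [ChartedSpace (EuclideanSpace ℝ (Fin 5)) M₂]
  {B : Type*} [TopologicalSpace B] [ChartedSpace (EuclideanSpace ℝ (Fin 6)) B]

/-- The projection `π₁ : B → M₁` of a submanifold `ι : B → M₁ × M₂`. -/
def proj₁ (ι : B → M₁ × M₂) (b : B) : M₁ := (ι b).1

/-- The projection `π₂ : B → M₂` of a submanifold `ι : B → M₁ × M₂`. -/
def proj₂ (ι : B → M₁ × M₂) (b : B) : M₂ := (ι b).2

/-- The `6`-dimensional submanifold `ι : B → M₁ × M₂` is a Bäcklund transformation between the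
hyperbolic Monge-Ampère systems `I₁` and `I₂`: the two projections `π₁`, `π₂` of `B` are
submersions, and the two systems have local generators with
`{Ψ₁, Ψ₂} ≡ {Θ₁, Θ₂} mod {θ₁, θ₂}` on `B`. -/
structure IsBacklundTransformation (I₁ : IdealField 5 M₁) (I₂ : IdealField 5 M₂)
    (ι : B → M₁ × M₂) : Prop where
  mongeAmpere₁ : IsHyperbolicMongeAmpere I₁
  mongeAmpere₂ : IsHyperbolicMongeAmpere I₂
  embedding : Manifold.IsSmoothEmbedding (𝓡 6) ((𝓡 5).prod (𝓡 5)) ∞ ι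
  submersion₁ : ∀ b, Function.Surjective (mfderiv (𝓡 6) (𝓡 5) (proj₁ ι) b)
  submersion₂ : ∀ b, Function.Surjective (mfderiv (𝓡 6) (𝓡 5) (proj₂ ι) b)
  compatible : ∀ b : B, ∃ (U₁ : Set M₁) (θ₁ : Form 5 M₁ 1) (Ψ₁ : Form 5 M₁ 2)
      (U₂ : Set M₂) (θ₂ : Form 5 M₂ 1) (Ψ₂ : Form 5 M₂ 2),
    proj₁ ι b ∈ U₁ ∧ IsMongeAmpereGenerator I₁ U₁ θ₁ Ψ₁ ∧
    proj₂ ι b ∈ U₂ ∧ IsMongeAmpereGenerator I₂ U₂ θ₂ Ψ₂ ∧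
    ∀ b' : B, proj₁ ι b' ∈ U₁ → proj₂ ι b' ∈ U₂ →
      FormIdeal.gen
          {Form.pullback (n := 6) (proj₁ ι) θ₁ b',
            Form.pullback (n := 6) (proj₂ ι) θ₂ b'}
          {Form.pullback (n := 6) (proj₁ ι) Ψ₁ b',
            Form.pullback (n := 6) (proj₂ ι) Ψ₂ b'} =
        FormIdeal.gen
          {Form.pullback (n := 6) (proj₁ ι) θ₁ b',
            Form.pullback (n := 6) (proj₂ ι) θ₂ b'}
          {Form.pullback (n := 6) (proj₁ ι) θ₁.d b',
            Form.pullback (n := 6) (proj₂ ι) θ₂.d b'}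

/-- The ideal on `B` generated by the pullback of `I₁`. -/
def ideal₁ (I₁ : IdealField 5 M₁) (ι : B → M₁ × M₂) : IdealField 6 B :=
  IdealField.pullback (proj₁ ι) I₁

/-- The ideal on `B` generated by the pullback of `I₂`. -/
def ideal₂ (I₂ : IdealField 5 M₂) (ι : B → M₁ × M₂) : IdealField 6 B :=
  IdealField.pullback (proj₂ ι) I₂

/-- A symmetry of the structure `(B, I₁, I₂)`: a diffeomorphism of `B` that preserves both of the
ideals that `I₁` and `I₂` generate on `B`. -/
def IsSymmetry (I₁ : IdealField 5 M₁) (I₂ : IdealField 5 M₂) (ι : B → M₁ × M₂)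
    (φ : B ≃ₘ^∞⟮𝓡 6, 𝓡 6⟯ B) : Prop :=
  IdealField.pullback φ (ideal₁ I₁ ι) = ideal₁ I₁ ι ∧
    IdealField.pullback φ (ideal₂ I₂ ι) = ideal₂ I₂ ι

/-- The symmetries act transitively on `B`. -/
def IsHomogeneous (I₁ : IdealField 5 M₁) (I₂ : IdealField 5 M₂) (ι : B → M₁ × M₂) : Prop :=
  ∀ p q : B, ∃ φ : B ≃ₘ^∞⟮𝓡 6, 𝓡 6⟯ B, IsSymmetry I₁ I₂ ι φ ∧ φ p = q

end Systems

/-! ### Adapted coframings -/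

section Coframings

variable {B : Type*} [TopologicalSpace B] [ChartedSpace (EuclideanSpace ℝ (Fin 6)) B]

/-- A smooth coframing `(θ₁, θ₂, ω¹, ω², ω³, ω⁴)` on `U ⊆ B`, in this order, together with the dual
frame (six covectors on a `6`-dimensional space form a basis exactly if they have a dual
frame, which is then unique). -/
structure Coframing (U : Set B) where
  form : Fin 6 → Form 6 B 1
  vec : Fin 6 → ∀ x : B, TangentSpace (𝓡 6) x
  smooth : ∀ i, (form i).SmoothOn U
  dual : ∀ x ∈ U, ∀ i j, form i x ![vec j x] = if i = j then 1 else 0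

namespace Coframing

variable {U : Set B} (η : Coframing U)

/-- `θ₁` -/
abbrev θ₁ : Form 6 B 1 := η.form 0

/-- `θ₂` -/
abbrev θ₂ : Form 6 B 1 := η.form 1

/-- `ω¹` -/
abbrev ω₁ : Form 6 B 1 := η.form 2

/-- `ω²` -/
abbrev ω₂ : Form 6 B 1 := η.form 3

/-- `ω³` -/
abbrev ω₃ : Form 6 B 1 := η.form 4

/-- `ω⁴` -/
abbrev ω₄ : Form 6 B 1 := η.form 5

/-- The coefficient of `η^j ∧ η^k` (for `j < k`) in the expansion of `d η^i` with respect to the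
coframing. -/
def coeff (i j k : Fin 6) (x : B) : ℝ := (η.form i).d x ![η.vec j x, η.vec k x]

/-- The vector `[B₁ B₂]`: the coefficients of `θ₁ ∧ θ₂` in `dω¹` and `dω²`. -/
def B₁₂ (x : B) : Fin 2 → ℝ := ![η.coeff 2 0 1 x, η.coeff 3 0 1 x]

/-- The vector `[B₃ B₄]`: the coefficients of `θ₁ ∧ θ₂` in `dω³` and `dω⁴`. -/
def B₃₄ (x : B) : Fin 2 → ℝ := ![η.coeff 4 0 1 x, η.coeff 5 0 1 x]

/-- The vector `[C₁ C₂]`: the coefficients of `ω³ ∧ ω⁴` in `dω¹` and `dω²`. -/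
def C₁₂ (x : B) : Fin 2 → ℝ := ![η.coeff 2 4 5 x, η.coeff 3 4 5 x]

/-- The vector `[C₃ C₄]`: the coefficients of `ω¹ ∧ ω²` in `dω³` and `dω⁴`. -/
def C₃₄ (x : B) : Fin 2 → ℝ := ![η.coeff 4 2 3 x, η.coeff 5 2 3 x]

variable {M₁ : Type*} [TopologicalSpace M₁] [ChartedSpace (EuclideanSpace ℝ (Fin 5)) M₁]
  {M₂ : Type*} [TopologicalSpace M₂] [ChartedSpace (EuclideanSpace ℝ (Fin 5)) M₂]

/-- The coframing is `0`-adapted: `θ₁` and `θ₂` generate the pulled back contact systems of `M₁` and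
`M₂`, the ideal generated by both systems is `{θ₁, θ₂, ω¹ ∧ ω², ω³ ∧ ω⁴}`, and
`dθ₁ ≡ A₁ ω¹ ∧ ω² + ω³ ∧ ω⁴ mod θ₁`, `dθ₂ ≡ ω¹ ∧ ω² + A₂ ω³ ∧ ω⁴ mod θ₂` for nonvanishing
functions `A₁`, `A₂` with `A₁ A₂ ≠ 1`. -/
structure IsZeroAdapted (I₁ : IdealField 5 M₁) (I₂ : IdealField 5 M₂) (ι : B → M₁ × M₂) :
    Prop where
  contact₁ : ∀ x ∈ U, (ideal₁ I₁ ι x).deg1 = Submodule.span ℝ {η.θ₁ x}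
  contact₂ : ∀ x ∈ U, (ideal₂ I₂ ι x).deg1 = Submodule.span ℝ {η.θ₂ x}
  ideal : ∀ x ∈ U, (ideal₁ I₁ ι x).sup (ideal₂ I₂ ι x) =
    FormIdeal.gen {η.θ₁ x, η.θ₂ x}
      {wedge (η.ω₁ x) (η.ω₂ x), wedge (η.ω₃ x) (η.ω₄ x)}
  structure_eq : ∃ A₁ A₂ : B → ℝ, ∀ x ∈ U, A₁ x ≠ 0 ∧ A₂ x ≠ 0 ∧ A₁ x * A₂ x ≠ 1 ∧
    (∃ γ, η.θ₁.d x = wedge γ (η.θ₁ x) +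
      A₁ x • wedge (η.ω₁ x) (η.ω₂ x) + wedge (η.ω₃ x) (η.ω₄ x)) ∧
    (∃ δ, η.θ₂.d x = wedge δ (η.θ₂ x) +
      wedge (η.ω₁ x) (η.ω₂ x) + A₂ x • wedge (η.ω₃ x) (η.ω₄ x))

/-- The coframing is `1`-adapted, in the case where `[C₁ C₂]` and `[C₃ C₄]` are both nonzero:
it is `0`-adapted with `C₁ = C₃ = 0` and `C₂ = C₄ = 1`. -/
structure IsOneAdapted (I₁ : IdealField 5 M₁) (I₂ : IdealField 5 M₂) (ι : B → M₁ × M₂) :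
    Prop extends η.IsZeroAdapted I₁ I₂ ι where
  C₁₂_eq : ∀ x ∈ U, η.C₁₂ x = ![0, 1]
  C₃₄_eq : ∀ x ∈ U, η.C₃₄ x = ![0, 1]

end Coframing

end Coframings

end Backlund

end

open Backlund

/-! Let e₀, …, e₅ be the frame dual to (θ₁, θ₂, ω¹, …, ω⁴). The fibres of π₁ are curves. Every
2-form pulled back from M₁ is killed by their tangent, and since dθ₁ is nondegenerate on the
ω-directions, this tangent is spanned by e₁, the vector dual to θ₂ (`mfderiv_vec`). Modulo θ₁ the
2-forms of I₁ pull back to combinations of ω¹∧ω² and ω³∧ω⁴, and hyperbolicity makes the pullbacks of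
dθ and Ψ independent there. Because both Φ and dΦ are killed by e₁ for each of these two forms, dω^a
has no term θ₂∧ω^b when a and b lie in different pairs {1,2}, {3,4} (`coeff_eq_zero`). The same
argument for π₂ removes the terms θ₁∧ω^b.

Now let B₁ = B₂ = 0 on an open set. The coefficients of θ₁∧θ₂∧ω³ and θ₁∧θ₂∧ω⁴ in d(dω²) = 0 then
reduce, up to sign, to C₂B₄ and C₂B₃. As C₂ = 1, both B₃ and B₄ vanish. The converse uses dω⁴ and C₄
= 1 (`coeff_zero_one_eq_zero`).

A symmetry preserves the lines of θ₁ and θ₂, and it preserves the pairs {ω¹, ω²}, {ω³, ω⁴} up to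
exchange (`transition_block`). So the vanishing of [B₁ B₂] and of [B₃ B₄] is carried from x to φ(x),
possibly exchanged (`vanish_transform`). Suppose exactly one of the two vectors vanished at x.
Nonvanishing of the other is an open condition, so a symmetry from x to a nearby point could not
exchange the pairs; the first vector would vanish on a neighbourhood, and by the equivalence so
would the second. Transitivity then spreads the alternative over U (`all_or_none_of_transitive`).

All differentiation passes through `d_of_vanish₁` and `d_of_vanish₂`: the derivative of a form is
evaluated on frame vectors on which the form vanishes identically, so no derivative of a coefficient
function appears. -/

namespace Backlund

/-! ### Forms of degree 1 and 2 as linear and bilinear maps; dual bases. -/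

section Alternating

theorem update_single {V : Type*} (a c : V) : Function.update ![a] 0 c = ![c] := by
  ext i; fin_cases i; rfl

theorem update_pair_zero {V : Type*} (a b c : V) : Function.update ![a, b] 0 c = ![c, b] := by
  ext i; fin_cases i <;> rfl

theorem update_pair_one {V : Type*} (a b c : V) : Function.update ![a, b] 1 c = ![a, c] := by
  ext i; fin_cases i <;> rfl

variable {V : Type*} [AddCommGroup V] [Module ℝ V] [TopologicalSpace V]

/-- A covector as a linear functional. -/
def lin (α : V [⋀^Fin 1]→L[ℝ] ℝ) : V →ₗ[ℝ] ℝ where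
  toFun w := α ![w]
  map_add' u w := by
    have h := α.map_update_add ![0] 0 u w
    simpa only [update_single] using h
  map_smul' c u := by
    have h := α.map_update_smul ![0] 0 c u
    simpa only [update_single, RingHom.id_apply] using h

@[simp] theorem lin_apply (α : V [⋀^Fin 1]→L[ℝ] ℝ) (w : V) : lin α w = α ![w] := rfl

/-- A `2`-form as a bilinear form. -/
def bilin (Φ : V [⋀^Fin 2]→L[ℝ] ℝ) : V →ₗ[ℝ] V →ₗ[ℝ] ℝ :=
  LinearMap.mk₂ ℝ (fun u w => Φ ![u, w])
    (fun u u' w => by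
      have h := Φ.map_update_add ![0, w] 0 u u'
      simpa only [update_pair_zero] using h)
    (fun c u w => by
      have h := Φ.map_update_smul ![0, w] 0 c u
      simpa only [update_pair_zero] using h)
    (fun u w w' => by
      have h := Φ.map_update_add ![u, 0] 1 w w'
      simpa only [update_pair_one] using h)
    (fun c u w => by
      have h := Φ.map_update_smul ![u, 0] 1 c w
      simpa only [update_pair_one] using h)

@[simp] theorem bilin_apply (Φ : V [⋀^Fin 2]→L[ℝ] ℝ) (u w : V) : bilin Φ u w = Φ ![u, w] := rfl

theorem two_form_self (Φ : V [⋀^Fin 2]→L[ℝ] ℝ) (u : V) : Φ ![u, u] = 0 :=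
  Φ.map_eq_zero_of_eq ![u, u] (i := 0) (j := 1) rfl (by decide)

theorem two_form_swap (Φ : V [⋀^Fin 2]→L[ℝ] ℝ) (u w : V) : Φ ![u, w] = - Φ ![w, u] := by
  have h := two_form_self Φ (u + w)
  rw [← bilin_apply, map_add, map_add, LinearMap.add_apply, LinearMap.add_apply] at h
  simp only [bilin_apply, two_form_self] at h
  linarith

theorem two_form_ext {Φ Ψ : V [⋀^Fin 2]→L[ℝ] ℝ} (h : ∀ u w, Φ ![u, w] = Ψ ![u, w]) : Φ = Ψ := by
  ext v
  have : v = ![v 0, v 1] := by ext i; fin_cases i <;> rfl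
  rw [this, h]

variable {n : ℕ} {h : Fin n → V [⋀^Fin 1]→L[ℝ] ℝ} {e : Fin n → V}

/-- `n` vectors of an `n`-dimensional space that have a dual family span. -/
theorem eq_sum_of_dual [FiniteDimensional ℝ V] (hn : Module.finrank ℝ V = n)
    (hd : ∀ i j, h i ![e j] = if i = j then 1 else 0) (w : V) :
    w = ∑ i, h i ![w] • e i := by
  have hli : LinearIndependent ℝ e := by
    rw [Fintype.linearIndependent_iff]
    intro c hc i
    have := congrArg (lin (h i)) hc
    rw [map_sum, map_zero] at this
    simpa [hd] using this
  have hsp := hli.span_eq_top_of_card_eq_finrank' (by simp [hn])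
  have hw : w ∈ Submodule.span ℝ (Set.range e) := by rw [hsp]; trivial
  obtain ⟨c, rfl⟩ := (Submodule.mem_span_range_iff_exists_fun ℝ).1 hw
  refine Finset.sum_congr rfl fun i _ => ?_
  rw [← lin_apply, map_sum]
  simp [hd]

end Alternating

/-! ### Moving frames and exterior derivatives in a vector space. -/

section VectorSpace

open Filter

variable {E : Type*} [NormedAddCommGroup E] [NormedSpace ℝ E]
  {n : ℕ} {h : Fin n → E → E [⋀^Fin 1]→L[ℝ] ℝ} {e : Fin n → E → E} {y : E}

/-- The dual frame of a differentiable coframing is differentiable. -/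
theorem differentiableAt_dual_frame [FiniteDimensional ℝ E] (hn : Module.finrank ℝ E = n)
    (hh : ∀ i, DifferentiableAt ℝ (h i) y)
    (hd : ∀ᶠ z in 𝓝 y, ∀ i j, h i z ![e j z] = if i = j then 1 else 0) (j : Fin n) :
    DifferentiableAt ℝ (e j) y := by
  let L : (E [⋀^Fin 1]→L[ℝ] ℝ) →L[ℝ] (E →L[ℝ] ℝ) :=
    (ContinuousAlternatingMap.ofSubsingletonLIE (𝕜 := ℝ) (E := E) (F := ℝ)
      (0 : Fin 1)).symm.toContinuousLinearEquiv
  -- The rows of `T z` are the coframing, so `e j z` is `(T z)⁻¹` applied to a standard basis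
  -- vector; differentiability comes from that of inversion.
  let T : E → E →L[ℝ] (Fin n → ℝ) := fun z => ContinuousLinearMap.pi fun i =>
    L (h i z)
  have hTapp : ∀ z w i, T z w i = h i z ![w] := by
    intro z w i
    show (ContinuousAlternatingMap.ofSubsingleton ℝ E ℝ (0 : Fin 1)).symm (h i z) w = _
    rw [ContinuousAlternatingMap.ofSubsingleton_symm_apply_apply]
    congr 1
    ext k; fin_cases k; rfl
  have hT : DifferentiableAt ℝ T y := by
    have : T = fun z => ∑ i, (ContinuousLinearMap.single ℝ (fun _ : Fin n => ℝ) i) ∘L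
        (L (h i z)) := by
      funext z; ext w i
      simp [T, Finset.sum_apply, Pi.single_apply]
    rw [this]
    refine DifferentiableAt.fun_sum fun i _ => ?_
    exact (differentiableAt_const _).clm_comp (L.differentiableAt.comp y (hh i))
  have hinv : ∀ᶠ z in 𝓝 y, (T z).IsInvertible ∧ T z (e j z) = Pi.single j 1 := by
    filter_upwards [hd] with z hz
    have hTe : ∀ k, T z (e k z) = Pi.single k 1 := by
      intro k; ext i
      rw [hTapp, hz, Pi.single_apply]
    refine ⟨?_, hTe j⟩
    have hinj : Function.Injective (T z) := by
      rw [injective_iff_map_eq_zero]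
      intro w hw
      rw [eq_sum_of_dual hn hz w]
      refine Finset.sum_eq_zero fun i _ => ?_
      rw [← hTapp, hw]
      simp
    let eq := LinearEquiv.ofInjectiveOfFinrankEq (T z : E →ₗ[ℝ] (Fin n → ℝ)) hinj (by simp [hn])
    exact ⟨eq.toContinuousLinearEquiv, by ext; rfl⟩
  have hE : CompleteSpace E := FiniteDimensional.complete ℝ E
  have h1 : DifferentiableAt ℝ (fun z => (T z).inverse (Pi.single j 1)) y :=
    ((hinv.self_of_nhds.1.contDiffAt_map_inverse (n := 1)).differentiableAt (by simp)
      |>.comp y hT).clm_apply (differentiableAt_const _)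
  refine h1.congr_of_eventuallyEq ?_
  filter_upwards [hinv] with z hz
  rw [← hz.2]
  obtain ⟨A, hA⟩ := hz.1
  rw [← hA]
  simp

theorem fderiv_one_form_apply {α : E → E [⋀^Fin 1]→L[ℝ] ℝ} {f : E → E}
    (hα : DifferentiableAt ℝ α y) (hf : DifferentiableAt ℝ f y) (u : E) :
    fderiv ℝ (fun z => α z ![f z]) y u = fderiv ℝ α y u ![f y] + α y ![fderiv ℝ f y u] := by
  have h1 := fderiv_continuousAlternatingMap_apply_apply (g := fun _ : Fin 1 => f) hα
    (fun _ => hf) u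
  have hv : ∀ w : E, (fun _ : Fin 1 => w) = ![w] := fun w => by ext i; fin_cases i; rfl
  simpa only [hv, Fin.sum_univ_one, update_single] using h1

theorem fderiv_two_form_apply {Φ : E → E [⋀^Fin 2]→L[ℝ] ℝ} {f g : E → E}
    (hΦ : DifferentiableAt ℝ Φ y) (hf : DifferentiableAt ℝ f y) (hg : DifferentiableAt ℝ g y)
    (u : E) :
    fderiv ℝ (fun z => Φ z ![f z, g z]) y u = fderiv ℝ Φ y u ![f y, g y] +
      (Φ y ![fderiv ℝ f y u, g y] + Φ y ![f y, fderiv ℝ g y u]) := by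
  have h1 := fderiv_continuousAlternatingMap_apply_apply (g := ![f, g]) hΦ
    (by intro i; fin_cases i <;> assumption) u
  have hv : ∀ z : E, (fun i : Fin 2 => (![f, g] : Fin 2 → E → E) i z) = ![f z, g z] :=
    fun w => by ext i; fin_cases i <;> rfl
  simpa only [hv, Fin.sum_univ_two, update_pair_zero, update_pair_one, Matrix.cons_val_zero,
    Matrix.cons_val_one] using h1

/-- Derivatives of a frame in terms of the derivatives of the dual coframing. -/
theorem fderiv_frame [FiniteDimensional ℝ E] (hn : Module.finrank ℝ E = n)
    (hh : ∀ i, DifferentiableAt ℝ (h i) y)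
    (hd : ∀ᶠ z in 𝓝 y, ∀ i j, h i z ![e j z] = if i = j then 1 else 0) (j : Fin n) (u : E) :
    fderiv ℝ (e j) y u = - ∑ i, fderiv ℝ (h i) y u ![e j y] • e i y := by
  have he := differentiableAt_dual_frame hn hh hd j
  rw [eq_sum_of_dual hn hd.self_of_nhds (fderiv ℝ (e j) y u), ← Finset.sum_neg_distrib]
  refine Finset.sum_congr rfl fun i _ => ?_
  -- The product rule for the pairing of `h i` with `e j`, which is constant near `y`.
  have h1 := fderiv_one_form_apply (hh i) he u
  have h2 : (fun z => h i z ![e j z]) =ᶠ[𝓝 y] fun _ => if i = j then (1 : ℝ) else 0 := by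
    filter_upwards [hd] with z hz using hz i j
  rw [h2.fderiv_eq, fderiv_fun_const] at h1
  rw [← neg_smul]
  congr 1
  simp only [Pi.zero_apply, _root_.zero_apply] at h1
  linarith

theorem extDeriv_one_form_apply {α : E → E [⋀^Fin 1]→L[ℝ] ℝ} (u w : E) :
    extDeriv α y ![u, w] = fderiv ℝ α y u ![w] - fderiv ℝ α y w ![u] := by
  rw [extDeriv, ContinuousAlternatingMap.alternatizeUncurryFin_apply, Fin.sum_univ_two]
  have h1 : (1 : Fin 2).removeNth ![u, w] = ![u] := by ext i; fin_cases i; rfl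
  simp [h1, sub_eq_add_neg]

theorem extDeriv_two_form_apply {Φ : E → E [⋀^Fin 2]→L[ℝ] ℝ} (u v w : E) :
    extDeriv Φ y ![u, v, w] = fderiv ℝ Φ y u ![v, w] - fderiv ℝ Φ y v ![u, w]
      + fderiv ℝ Φ y w ![u, v] := by
  rw [extDeriv, ContinuousAlternatingMap.alternatizeUncurryFin_apply, Fin.sum_univ_three]
  have h1 : (1 : Fin 3).removeNth ![u, v, w] = ![u, w] := by ext i; fin_cases i <;> rfl
  have h2 : (2 : Fin 3).removeNth ![u, v, w] = ![u, v] := by ext i; fin_cases i <;> rfl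
  simp [h1, h2, sub_eq_add_neg]

/-- The exterior derivative of a `1`-form on two vectors of a frame that it annihilates. -/
theorem extDeriv_frame_of_vanish₁ [FiniteDimensional ℝ E] (hn : Module.finrank ℝ E = n)
    (hh : ∀ i, DifferentiableAt ℝ (h i) y)
    (hd : ∀ᶠ z in 𝓝 y, ∀ i j, h i z ![e j z] = if i = j then 1 else 0)
    {α : E → E [⋀^Fin 1]→L[ℝ] ℝ} (hα : DifferentiableAt ℝ α y) {a b : Fin n}
    (ha : ∀ᶠ z in 𝓝 y, α z ![e a z] = 0) (hb : ∀ᶠ z in 𝓝 y, α z ![e b z] = 0) :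
    extDeriv α y ![e a y, e b y] =
      ∑ i, α y ![e i y] * extDeriv (h i) y ![e a y, e b y] := by
  -- Differentiating α(e_j) = 0 trades the derivative of α for that of the coframing. In bracket
  -- terms: dα(e_a, e_b) = -α([e_a, e_b]), and [e_a, e_b] = -∑ dhⁱ(e_a, e_b) e_i.
  have key : ∀ j u, (∀ᶠ z in 𝓝 y, α z ![e j z] = 0) →
      fderiv ℝ α y u ![e j y] = ∑ i, α y ![e i y] * fderiv ℝ (h i) y u ![e j y] := by
    intro j u hj
    have h1 := fderiv_one_form_apply hα (differentiableAt_dual_frame hn hh hd j) u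
    have h2 : (fun z => α z ![e j z]) =ᶠ[𝓝 y] fun _ => (0 : ℝ) := hj
    rw [h2.fderiv_eq, fderiv_fun_const, fderiv_frame hn hh hd, ← lin_apply (α y), map_neg, map_sum] at h1
    simp only [Pi.zero_apply, _root_.zero_apply, map_smul, lin_apply,
      smul_eq_mul] at h1
    simp only [mul_comm (α y _)]
    linarith
  rw [extDeriv_one_form_apply, key b _ hb, key a _ ha, ← Finset.sum_sub_distrib]
  refine Finset.sum_congr rfl fun i _ => ?_
  rw [extDeriv_one_form_apply]
  ring

/-- The exterior derivative of a `2`-form on three vectors of a frame that are pairwise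
orthogonal for it. -/
theorem extDeriv_frame_of_vanish₂ [FiniteDimensional ℝ E] (hn : Module.finrank ℝ E = n)
    (hh : ∀ i, DifferentiableAt ℝ (h i) y)
    (hd : ∀ᶠ z in 𝓝 y, ∀ i j, h i z ![e j z] = if i = j then 1 else 0)
    {Φ : E → E [⋀^Fin 2]→L[ℝ] ℝ} (hΦ : DifferentiableAt ℝ Φ y) {a b c : Fin n}
    (hbc : ∀ᶠ z in 𝓝 y, Φ z ![e b z, e c z] = 0) (hac : ∀ᶠ z in 𝓝 y, Φ z ![e a z, e c z] = 0)
    (hab : ∀ᶠ z in 𝓝 y, Φ z ![e a z, e b z] = 0) :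
    extDeriv Φ y ![e a y, e b y, e c y] =
      ∑ i, (extDeriv (h i) y ![e a y, e b y] * Φ y ![e i y, e c y]
        + extDeriv (h i) y ![e b y, e c y] * Φ y ![e i y, e a y]
        + extDeriv (h i) y ![e c y, e a y] * Φ y ![e i y, e b y]) := by
  have key : ∀ j k u, (∀ᶠ z in 𝓝 y, Φ z ![e j z, e k z] = 0) →
      fderiv ℝ Φ y u ![e j y, e k y] = ∑ i, (fderiv ℝ (h i) y u ![e j y] * Φ y ![e i y, e k y]
        - fderiv ℝ (h i) y u ![e k y] * Φ y ![e i y, e j y]) := by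
    intro j k u hj
    have h1 := fderiv_two_form_apply hΦ (differentiableAt_dual_frame hn hh hd j)
      (differentiableAt_dual_frame hn hh hd k) u
    have h2 : (fun z => Φ z ![e j z, e k z]) =ᶠ[𝓝 y] fun _ => (0 : ℝ) := hj
    rw [h2.fderiv_eq, fderiv_fun_const, fderiv_frame hn hh hd, fderiv_frame hn hh hd] at h1
    simp only [← bilin_apply (Φ y), map_neg, map_sum, Pi.zero_apply,
      _root_.zero_apply, map_smul,
      LinearMap.neg_apply, LinearMap.sum_apply, LinearMap.smul_apply, smul_eq_mul] at h1
    simp only [bilin_apply, two_form_swap (Φ y) (e j y), mul_neg, Finset.sum_neg_distrib] at h1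
    rw [Finset.sum_sub_distrib]
    linarith
  rw [extDeriv_two_form_apply, key b c _ hbc, key a c _ hac, key a b _ hab,
    ← Finset.sum_sub_distrib, ← Finset.sum_add_distrib]
  refine Finset.sum_congr rfl fun i _ => ?_
  simp only [extDeriv_one_form_apply]
  ring

end VectorSpace
-- The exterior derivative on a manifold: naturality and independence of the chart.
section Manifolds

open Filter

variable {m n k : ℕ}
  {M : Type*} [TopologicalSpace M] [ChartedSpace (EuclideanSpace ℝ (Fin n)) M]
  {N : Type*} [TopologicalSpace N] [ChartedSpace (EuclideanSpace ℝ (Fin m)) N]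

/-- Tangent spaces at different points are all the model space, so the vectors can be compared there
even though their types depend on the base point. -/
theorem Form.apply_congr (α : Form n M k) {x x' : M} (h : x = x')
    {v : Fin k → TangentSpace (𝓡 n) x} {w : Fin k → TangentSpace (𝓡 n) x'}
    (hvw : ∀ i, @Eq (EuclideanSpace ℝ (Fin n)) (v i) (w i)) : α x v = α x' w := by
  subst h
  exact congrArg (α x) (funext hvw)

theorem mdifferentiableAt_extChartAt_symm [IsManifold (𝓡 n) 1 M] {c : M}
    {y : EuclideanSpace ℝ (Fin n)} (hy : y ∈ (extChartAt (𝓡 n) c).target) :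
    MDifferentiableAt 𝓘(ℝ, EuclideanSpace ℝ (Fin n)) (𝓡 n) (extChartAt (𝓡 n) c).symm y := by
  have h := mdifferentiableWithinAt_extChartAt_symm (I := 𝓡 n) hy
  rwa [ModelWithCorners.range_eq_univ, mdifferentiableWithinAt_univ] at h

theorem mfderiv_symm_comp_mfderiv_extChartAt [IsManifold (𝓡 n) 1 M] {c x : M}
    (hx : x ∈ (extChartAt (𝓡 n) c).source) (v : TangentSpace (𝓡 n) x) :
    mfderiv 𝓘(ℝ, EuclideanSpace ℝ (Fin n)) (𝓡 n) (extChartAt (𝓡 n) c).symm (extChartAt (𝓡 n) c x)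
      (mfderiv (𝓡 n) 𝓘(ℝ, EuclideanSpace ℝ (Fin n)) (extChartAt (𝓡 n) c) x v) = v := by
  have h := mfderivWithin_extChartAt_symm_comp_mfderiv_extChartAt' (I := 𝓡 n) hx
  rw [ModelWithCorners.range_eq_univ, mfderivWithin_univ] at h
  exact congrArg (fun L => L v) h

theorem contDiffAt_writtenInExtChartAt {f : M → N} {c : M} {r : ℕ∞ω} (hf : ContMDiffAt (𝓡 n) (𝓡 m) r f c) :
    ContDiffAt ℝ r (writtenInExtChartAt (𝓡 n) (𝓡 m) c f) (extChartAt (𝓡 n) c c) := by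
  have h := (contMDiffAt_iff.1 hf).2
  rwa [ModelWithCorners.range_eq_univ, contDiffWithinAt_univ] at h

/-- The chain rule, applied to the two ways of writing `f` composed with the inverse charts. It
reduces pullback on manifolds to pullback between model spaces, where `extDeriv_pullback` applies.
-/
theorem Form.coord_pullback [IsManifold (𝓡 n) 2 M] [IsManifold (𝓡 m) 2 N] {f : M → N} {c : M}
    (hf : ContMDiffAt (𝓡 n) (𝓡 m) 2 f c) (α : Form m N k) :
    ∀ᶠ y in 𝓝 (extChartAt (𝓡 n) c c), (Form.pullback (n := n) f α).coord c y =
      (α.coord (f c) (writtenInExtChartAt (𝓡 n) (𝓡 m) c f y)).compContinuousLinearMap (fderiv ℝ (writtenInExtChartAt (𝓡 n) (𝓡 m) c f) y) := by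
  have : IsManifold (𝓡 n) 1 M := .of_le (n := 2) (by norm_num)
  have : IsManifold (𝓡 m) 1 N := .of_le (n := 2) (by norm_num)
  have hcont : Tendsto (extChartAt (𝓡 n) c).symm (𝓝 (extChartAt (𝓡 n) c c)) (𝓝 c) := by
    have h := continuousAt_extChartAt_symm (I := 𝓡 n) c
    rwa [ContinuousAt, extChartAt_to_inv] at h
  have h1 : ∀ᶠ y in 𝓝 (extChartAt (𝓡 n) c c),
      MDifferentiableAt (𝓡 n) (𝓡 m) f ((extChartAt (𝓡 n) c).symm y) := by
    have h := (contMDiffAt_iff_contMDiffAt_nhds (by simp)).1 hf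
    have h2 := hcont.eventually h
    filter_upwards [h2] with y hy using hy.mdifferentiableAt (by simp)
  have h2 : ∀ᶠ y in 𝓝 (extChartAt (𝓡 n) c c), y ∈ (extChartAt (𝓡 n) c).target :=
    extChartAt_target_mem_nhds c
  have h3 : ∀ᶠ y in 𝓝 (extChartAt (𝓡 n) c c),
      f ((extChartAt (𝓡 n) c).symm y) ∈ (extChartAt (𝓡 m) (f c)).source := by
    have h : ∀ᶠ x in 𝓝 c, f x ∈ (extChartAt (𝓡 m) (f c)).source :=
      hf.continuousAt.tendsto.eventually (extChartAt_source_mem_nhds (f c))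
    exact hcont.eventually h
  have h4 := ((contDiffAt_writtenInExtChartAt hf).eventually (by simp)).mono
    fun y hy => hy.differentiableAt (by simp)
  filter_upwards [h1, h2, h3, h4, h3.eventually_nhds] with y h1 h2 h3 h4 h5
  have hchain : (extChartAt (𝓡 m) (f c)).symm ∘ writtenInExtChartAt (𝓡 n) (𝓡 m) c f =ᶠ[𝓝 y]
      f ∘ (extChartAt (𝓡 n) c).symm := by
    filter_upwards [h5] with z hz
    exact (extChartAt (𝓡 m) (f c)).left_inv hz
  have hm := hchain.mfderiv_eq (I := 𝓘(ℝ, EuclideanSpace ℝ (Fin n))) (I' := 𝓡 m)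
  rw [mfderiv_comp (I' := 𝓡 n) y h1 (mdifferentiableAt_extChartAt_symm h2),
    mfderiv_comp (I' := 𝓘(ℝ, EuclideanSpace ℝ (Fin m))) y
      (mdifferentiableAt_extChartAt_symm ((extChartAt (𝓡 m) (f c)).map_source h3))
      h4.mdifferentiableAt, mfderiv_eq_fderiv] at hm
  ext v
  exact Form.apply_congr α ((extChartAt (𝓡 m) (f c)).left_inv h3).symm
    fun i => (congrArg (fun L => L (v i)) hm).symm

theorem writtenInExtChartAt_self_apply (f : M → N) (c : M) :
    writtenInExtChartAt (𝓡 n) (𝓡 m) c f (extChartAt (𝓡 n) c c) = extChartAt (𝓡 m) (f c) (f c) := by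
  simp [writtenInExtChartAt]

theorem Form.differentiableAt_coord_pullback [IsManifold (𝓡 n) 2 M] [IsManifold (𝓡 m) 2 N]
    {f : M → N} {c : M} (hf : ContMDiffAt (𝓡 n) (𝓡 m) 2 f c) {α : Form m N k}
    (hα : DifferentiableAt ℝ (α.coord (f c)) (extChartAt (𝓡 m) (f c) (f c))) :
    DifferentiableAt ℝ ((Form.pullback (n := n) f α).coord c) (extChartAt (𝓡 n) c c) := by
  have hτ := contDiffAt_writtenInExtChartAt hf
  refine DifferentiableAt.congr_of_eventuallyEq ?_ (Form.coord_pullback hf α)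
  rw [← writtenInExtChartAt_self_apply (n := n)] at hα
  exact (hα.comp _ (hτ.differentiableAt (by simp))).continuousAlternatingMapCompContinuousLinearMap
    ((hτ.fderiv_right (m := 1) (by norm_num)).differentiableAt (by simp))

/-- The exterior derivative commutes with pullbacks. -/
theorem Form.d_pullback [IsManifold (𝓡 n) 2 M] [IsManifold (𝓡 m) 2 N]
    {f : M → N} {c : M} (hf : ContMDiffAt (𝓡 n) (𝓡 m) 2 f c) {α : Form m N k}
    (hα : DifferentiableAt ℝ (α.coord (f c)) (extChartAt (𝓡 m) (f c) (f c))) :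
    (Form.pullback (n := n) f α).d c = Form.pullback (n := n) f α.d c := by
  have : IsManifold (𝓡 n) 1 M := .of_le (n := 2) (by norm_num)
  have : IsManifold (𝓡 m) 1 N := .of_le (n := 2) (by norm_num)
  have hτ := contDiffAt_writtenInExtChartAt hf
  have hα' := hα
  rw [← writtenInExtChartAt_self_apply (n := n)] at hα'
  have hfm : MDifferentiableAt (𝓡 n) (𝓡 m) f c := hf.mdifferentiableAt (by simp)
  have hchain : writtenInExtChartAt (𝓡 n) (𝓡 m) c f ∘ extChartAt (𝓡 n) c =ᶠ[𝓝 c]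
      extChartAt (𝓡 m) (f c) ∘ f := by
    filter_upwards [extChartAt_source_mem_nhds (I := 𝓡 n) c] with z hz
    simp only [writtenInExtChartAt, Function.comp_apply, (extChartAt (𝓡 n) c).left_inv hz]
  have hm := hchain.mfderiv_eq (I := 𝓡 n) (I' := 𝓘(ℝ, EuclideanSpace ℝ (Fin m)))
  rw [mfderiv_comp (I' := 𝓘(ℝ, EuclideanSpace ℝ (Fin n))) c
      (hτ.differentiableAt (by simp)).mdifferentiableAt
      (mdifferentiableAt_extChartAt (mem_chart_source _ c)),
    mfderiv_comp (I' := 𝓡 m) c (mdifferentiableAt_extChartAt (mem_chart_source _ (f c))) hfm,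
    mfderiv_eq_fderiv] at hm
  have h1 := (EventuallyEq.extDeriv_eq (Form.coord_pullback hf α)).trans
    (extDeriv_pullback hα' hτ (by simp))
  rw [Form.d, h1, writtenInExtChartAt_self_apply]
  ext v
  refine congrArg (extDeriv (α.coord (f c)) (extChartAt (𝓡 m) (f c) (f c))) (funext fun i => ?_)
  exact congrArg (fun L => L (v i)) hm

theorem Form.coord_modelSpace (β : Form n (EuclideanSpace ℝ (Fin n)) k)
    (y : EuclideanSpace ℝ (Fin n)) : β.coord y = β := by
  funext z
  ext v
  have h : (extChartAt (𝓡 n) y).symm = (id : EuclideanSpace ℝ (Fin n) → _) := by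
    simp [chartAt_self_eq]
  rw [Form.coord]
  refine Form.apply_congr β (congrFun h z) fun i => ?_
  rw [h]
  exact congrArg (fun L : EuclideanSpace ℝ (Fin n) →L[ℝ] EuclideanSpace ℝ (Fin n) => L (v i))
    (mfderiv_id (I := 𝓡 n))

theorem Form.d_modelSpace (β : Form n (EuclideanSpace ℝ (Fin n)) k)
    (y : EuclideanSpace ℝ (Fin n)) : β.d y = extDeriv β y := by
  have h : extChartAt (𝓡 n) y = (id : EuclideanSpace ℝ (Fin n) → _) := by
    simp [chartAt_self_eq]
  rw [Form.d, Form.coord_modelSpace, h]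
  ext v
  refine congrArg (extDeriv β y) (funext fun i => ?_)
  exact congrArg (fun L : EuclideanSpace ℝ (Fin n) →L[ℝ] EuclideanSpace ℝ (Fin n) => L (v i))
    (mfderiv_id (I := 𝓡 n))

/-- The coordinate expression of the exterior derivative, in any preferred chart. -/
theorem Form.coord_d [IsManifold (𝓡 n) 2 M] {α : Form n M k} {c : M}
    {y : EuclideanSpace ℝ (Fin n)} (hy : y ∈ (extChartAt (𝓡 n) c).target)
    (hα : DifferentiableAt ℝ (α.coord ((extChartAt (𝓡 n) c).symm y))
      (extChartAt (𝓡 n) ((extChartAt (𝓡 n) c).symm y) ((extChartAt (𝓡 n) c).symm y))) :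
    α.d.coord c y = extDeriv (α.coord c) y := by
  -- The inverse chart is treated as a map from the model space, viewed as a manifold whose
  -- preferred charts are the identity; naturality of d along it gives the claim.
  have hs : ContMDiffAt (𝓡 n) (𝓡 n) 2 (extChartAt (𝓡 n) c).symm y :=
    (contMDiffOn_extChartAt_symm c).contMDiffAt ((isOpen_extChartAt_target c).mem_nhds hy)
  have h := Form.d_pullback (n := n) hs hα
  rw [Form.d_modelSpace] at h
  exact h.symm

end Manifolds
-- Iterated exterior derivatives and calculus with a coframing on B.
section Frames

open Filter

variable {n k : ℕ} {M : Type*} [TopologicalSpace M] [ChartedSpace (EuclideanSpace ℝ (Fin n)) M]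

/-- The form `α` is differentiable at `c`, read in the preferred chart. -/
def Form.DiffAt (α : Form n M k) (c : M) : Prop :=
  DifferentiableAt ℝ (α.coord c) (extChartAt (𝓡 n) c c)

theorem Form.SmoothOn.diffAt {α : Form n M k} {U : Set M} (hα : α.SmoothOn U) {c : M}
    (hc : c ∈ U) : α.DiffAt c := (hα c hc).differentiableAt (by simp)

/-- `Form.d` uses a different chart at each point. Smoothness of dα and d² = 0 need it read near `c`
in one fixed chart. -/
theorem eventually_coord_d [IsManifold (𝓡 n) 2 M] {α : Form n M k} {U : Set M} (hU : IsOpen U)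
    (hα : α.SmoothOn U) {c : M} (hc : c ∈ U) :
    ∀ᶠ y in 𝓝 (extChartAt (𝓡 n) c c), α.d.coord c y = extDeriv (α.coord c) y := by
  have h := continuousAt_extChartAt_symm (I := 𝓡 n) c
  rw [ContinuousAt, extChartAt_to_inv] at h
  filter_upwards [h.eventually (hU.mem_nhds hc), extChartAt_target_mem_nhds c] with y hy hy'
  exact Form.coord_d hy' (hα.diffAt hy)

theorem Form.SmoothOn.contDiffAt_extDeriv {α : Form n M k} {U : Set M} (hα : α.SmoothOn U) {c : M}
    (hc : c ∈ U) : ContDiffAt ℝ ∞ (extDeriv (α.coord c)) (extChartAt (𝓡 n) c c) :=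
  (ContinuousAlternatingMap.alternatizeUncurryFinCLM ℝ
    (EuclideanSpace ℝ (Fin n)) ℝ).contDiff.contDiffAt.comp _ ((hα c hc).fderiv_right (by simp))

theorem Form.SmoothOn.d [IsManifold (𝓡 n) 2 M] {α : Form n M k} {U : Set M} (hU : IsOpen U)
    (hα : α.SmoothOn U) : α.d.SmoothOn U := fun _ hc =>
  (hα.contDiffAt_extDeriv hc).congr_of_eventuallyEq (eventually_coord_d hU hα hc)

theorem Form.SmoothOn.d_d [IsManifold (𝓡 n) 2 M] {α : Form n M k} {U : Set M} (hU : IsOpen U)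
    (hα : α.SmoothOn U) {c : M} (hc : c ∈ U) : α.d.d c = 0 := by
  rw [Form.d, (EventuallyEq.extDeriv_eq (eventually_coord_d hU hα hc)),
    extDeriv_extDeriv_apply (hα c hc) (by simpa using ENat.LEInfty.out)]
  rfl

theorem Form.coord_extChartAt_apply [IsManifold (𝓡 n) 1 M] (α : Form n M k) {c x : M}
    (hx : x ∈ (extChartAt (𝓡 n) c).source) (v : Fin k → TangentSpace (𝓡 n) x) :
    α.coord c (extChartAt (𝓡 n) c x)
      (fun i => mfderiv (𝓡 n) 𝓘(ℝ, EuclideanSpace ℝ (Fin n)) (extChartAt (𝓡 n) c) x (v i)) = α x v :=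
  Form.apply_congr α ((extChartAt (𝓡 n) c).left_inv hx)
    fun i => mfderiv_symm_comp_mfderiv_extChartAt hx (v i)

/-- A vector field in the preferred chart at `c`. -/
noncomputable def chartField (X : ∀ x : M, TangentSpace (𝓡 n) x) (c : M)
    (y : EuclideanSpace ℝ (Fin n)) :
    EuclideanSpace ℝ (Fin n) :=
  mfderiv (𝓡 n) 𝓘(ℝ, EuclideanSpace ℝ (Fin n)) (extChartAt (𝓡 n) c) ((extChartAt (𝓡 n) c).symm y)
    (X ((extChartAt (𝓡 n) c).symm y))

theorem Form.coord_chartField₁ [IsManifold (𝓡 n) 1 M] (α : Form n M 1) {c : M}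
    {y : EuclideanSpace ℝ (Fin n)} (hy : y ∈ (extChartAt (𝓡 n) c).target)
    (X : ∀ x : M, TangentSpace (𝓡 n) x) :
    α.coord c y ![chartField X c y] =
      α ((extChartAt (𝓡 n) c).symm y) ![X ((extChartAt (𝓡 n) c).symm y)] := by
  rw [← Form.coord_extChartAt_apply α ((extChartAt (𝓡 n) c).map_target hy),
    (extChartAt (𝓡 n) c).right_inv hy]
  congr 1
  ext i; fin_cases i; rfl

theorem Form.coord_chartField₂ [IsManifold (𝓡 n) 1 M] (α : Form n M 2) {c : M}
    {y : EuclideanSpace ℝ (Fin n)} (hy : y ∈ (extChartAt (𝓡 n) c).target)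
    (X Y : ∀ x : M, TangentSpace (𝓡 n) x) :
    α.coord c y ![chartField X c y, chartField Y c y] =
      α ((extChartAt (𝓡 n) c).symm y)
        ![X ((extChartAt (𝓡 n) c).symm y), Y ((extChartAt (𝓡 n) c).symm y)] := by
  rw [← Form.coord_extChartAt_apply α ((extChartAt (𝓡 n) c).map_target hy),
    (extChartAt (𝓡 n) c).right_inv hy]
  congr 1
  ext i; fin_cases i <;> rfl

theorem chartField_self [IsManifold (𝓡 n) 1 M] (X : ∀ x : M, TangentSpace (𝓡 n) x) (c : M) :
    chartField X c (extChartAt (𝓡 n) c c) = X c := by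
  have h := extChartAt_to_inv (I := 𝓡 n) c
  rw [chartField, h, mfderiv_extChartAt_self]
  rfl

theorem Form.coord_self [IsManifold (𝓡 n) 1 M] (α : Form n M k) (c : M) :
    α.coord c (extChartAt (𝓡 n) c c) = α c := by
  ext v
  refine Eq.trans ?_ (Form.coord_extChartAt_apply α (mem_extChartAt_source c) v)
  rw [mfderiv_extChartAt_self]; rfl

theorem Form.d_eq_extDeriv [IsManifold (𝓡 n) 1 M] (α : Form n M k) (c : M) :
    α.d c = extDeriv (α.coord c) (extChartAt (𝓡 n) c c) := by
  rw [Form.d, mfderiv_extChartAt_self]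
  rfl

namespace Coframing

variable {B : Type*} [TopologicalSpace B] [ChartedSpace (EuclideanSpace ℝ (Fin 6)) B]
  {U : Set B} (η : Coframing U)

theorem eventually_chart {c : B} {p : B → Prop} (hp : ∀ᶠ x in 𝓝 c, p x) :
    ∀ᶠ y in 𝓝 (extChartAt (𝓡 6) c c), p ((extChartAt (𝓡 6) c).symm y) := by
  have h := continuousAt_extChartAt_symm (I := 𝓡 6) c
  rw [ContinuousAt, extChartAt_to_inv] at h
  exact h.eventually hp

theorem eventually_dual_chartField [IsManifold (𝓡 6) 1 B] (hU : IsOpen U) {c : B} (hc : c ∈ U) :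
    ∀ᶠ y in 𝓝 (extChartAt (𝓡 6) c c), ∀ i j,
      (η.form i).coord c y ![chartField (η.vec j) c y] = if i = j then 1 else 0 := by
  filter_upwards [eventually_chart (hU.mem_nhds hc), extChartAt_target_mem_nhds c] with y hy hy' i j
  rw [Form.coord_chartField₁ _ hy', η.dual _ hy]

theorem differentiableAt_chartField [IsManifold (𝓡 6) 1 B] (hU : IsOpen U) {c : B} (hc : c ∈ U)
    (j : Fin 6) : DifferentiableAt ℝ (chartField (η.vec j) c) (extChartAt (𝓡 6) c c) :=
  differentiableAt_dual_frame (n := 6) (by simp) (fun i => (η.smooth i).diffAt hc)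
    (η.eventually_dual_chartField hU hc) j

/-- The exterior derivative of a `1`-form on two vectors of the frame that it annihilates. -/
theorem d_of_vanish₁ [IsManifold (𝓡 6) 1 B] (hU : IsOpen U) {c : B} (hc : c ∈ U)
    {α : Form 6 B 1} (hα : α.DiffAt c) {a b : Fin 6}
    (ha : ∀ᶠ x in 𝓝 c, α x ![η.vec a x] = 0) (hb : ∀ᶠ x in 𝓝 c, α x ![η.vec b x] = 0) :
    α.d c ![η.vec a c, η.vec b c] = ∑ i, α c ![η.vec i c] * η.coeff i a b c := by
  have key := extDeriv_frame_of_vanish₁ (n := 6) (by simp) (fun i => (η.smooth i).diffAt hc)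
    (η.eventually_dual_chartField hU hc) (a := a) (b := b) hα
    (by
      filter_upwards [eventually_chart ha, extChartAt_target_mem_nhds c] with y hy hy'
      rw [Form.coord_chartField₁ _ hy', hy])
    (by
      filter_upwards [eventually_chart hb, extChartAt_target_mem_nhds c] with y hy hy'
      rw [Form.coord_chartField₁ _ hy', hy])
  simp only [chartField_self, Form.coord_self, ← Form.d_eq_extDeriv] at key
  exact key

/-- The exterior derivative of a `2`-form on three vectors of the frame that are pairwise
orthogonal for it. -/
theorem d_of_vanish₂ [IsManifold (𝓡 6) 1 B] (hU : IsOpen U) {c : B} (hc : c ∈ U)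
    {Φ : Form 6 B 2} (hΦ : Φ.DiffAt c) {a b d : Fin 6}
    (hbd : ∀ᶠ x in 𝓝 c, Φ x ![η.vec b x, η.vec d x] = 0)
    (had : ∀ᶠ x in 𝓝 c, Φ x ![η.vec a x, η.vec d x] = 0)
    (hab : ∀ᶠ x in 𝓝 c, Φ x ![η.vec a x, η.vec b x] = 0) :
    Φ.d c ![η.vec a c, η.vec b c, η.vec d c] =
      ∑ i, (η.coeff i a b c * Φ c ![η.vec i c, η.vec d c]
        + η.coeff i b d c * Φ c ![η.vec i c, η.vec a c]
        + η.coeff i d a c * Φ c ![η.vec i c, η.vec b c]) := by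
  have key := extDeriv_frame_of_vanish₂ (n := 6) (by simp) (fun i => (η.smooth i).diffAt hc)
    (η.eventually_dual_chartField hU hc) (a := a) (b := b) (c := d) hΦ
    (by
      filter_upwards [eventually_chart hbd, extChartAt_target_mem_nhds c] with y hy hy'
      rw [Form.coord_chartField₂ _ hy', hy])
    (by
      filter_upwards [eventually_chart had, extChartAt_target_mem_nhds c] with y hy hy'
      rw [Form.coord_chartField₂ _ hy', hy])
    (by
      filter_upwards [eventually_chart hab, extChartAt_target_mem_nhds c] with y hy hy'
      rw [Form.coord_chartField₂ _ hy', hy])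
  simp only [chartField_self, Form.coord_self, ← Form.d_eq_extDeriv] at key
  exact key

/-- Only the covectors are assumed smooth. In the chart at `c`, both the derivative of the covector
and the dual frame are differentiable, hence so is the coefficient. -/
theorem continuousAt_coeff [IsManifold (𝓡 6) 2 B] (hU : IsOpen U) {c : B} (hc : c ∈ U)
    (i j k : Fin 6) : ContinuousAt (η.coeff i j k) c := by
  have : IsManifold (𝓡 6) 1 B := .of_le (n := 2) (by norm_num)
  have hc' : ContinuousAt (fun y => (extDeriv ((η.form i).coord c) y)
      ![chartField (η.vec j) c y, chartField (η.vec k) c y]) (extChartAt (𝓡 6) c c) := by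
    have h := DifferentiableAt.continuousAlternatingMap_apply
      (g := ![chartField (η.vec j) c, chartField (η.vec k) c])
      (((η.smooth i).contDiffAt_extDeriv hc).differentiableAt (by simp))
      (by
        intro l
        fin_cases l
        · exact η.differentiableAt_chartField hU hc j
        · exact η.differentiableAt_chartField hU hc k)
    refine h.continuousAt.congr (Eventually.of_forall fun y => ?_)
    refine congrArg (extDeriv ((η.form i).coord c) y) (funext fun l => ?_)
    fin_cases l <;> rfl
  have h2 := hc'.comp (f := extChartAt (𝓡 6) c) (continuousAt_extChartAt c)
  refine h2.congr ?_
  filter_upwards [(continuousAt_extChartAt (I := 𝓡 6) c).eventually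
    (eventually_coord_d hU (η.smooth i) hc), extChartAt_source_mem_nhds (I := 𝓡 6) c] with x hx hx'
  have hl := (extChartAt (𝓡 6) c).left_inv hx'
  have h3 := Form.coord_chartField₂ (η.form i).d ((extChartAt (𝓡 6) c).map_source hx') (η.vec j)
    (η.vec k)
  rw [Function.comp_apply, ← hx]
  refine h3.trans ?_
  rw [hl]; rfl

end Coframing

end Frames
-- Divisibility by a covector and hyperbolic pencils in one tangent space.
section Pointwise

variable {V : Type*} [AddCommGroup V] [Module ℝ V] [TopologicalSpace V]

/-- The contraction of a `2`-form with a vector. -/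
noncomputable def contract (Φ : V [⋀^Fin 2]→L[ℝ] ℝ) (u : V) : V [⋀^Fin 1]→L[ℝ] ℝ :=
  ContinuousAlternatingMap.ofSubsingleton ℝ V ℝ (0 : Fin 1)
    ⟨bilin Φ u, Φ.cont.comp (continuous_pi fun i => by
      fin_cases i
      · exact continuous_const
      · exact continuous_id)⟩

@[simp] theorem contract_apply (Φ : V [⋀^Fin 2]→L[ℝ] ℝ) (u w : V) :
    contract Φ u ![w] = Φ ![u, w] := rfl

/-- A `2`-form that vanishes on the kernel of `θ` is divisible by `θ`. -/
theorem eq_wedge_contract {θ : V [⋀^Fin 1]→L[ℝ] ℝ} {Φ : V [⋀^Fin 2]→L[ℝ] ℝ} {e : V}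
    (he : θ ![e] = 1) (hΦ : ∀ u w, θ ![u] = 0 → θ ![w] = 0 → Φ ![u, w] = 0) :
    Φ = wedge θ (contract Φ e) := by
  have hk : ∀ u, θ ![u - θ ![u] • e] = 0 := by
    intro u
    rw [← lin_apply, map_sub, map_smul, lin_apply, lin_apply, he]
    simp
  refine two_form_ext fun u w => ?_
  have h := hΦ _ _ (hk u) (hk w)
  rw [← bilin_apply, map_sub, map_sub, map_smul, LinearMap.sub_apply, map_smul,
    LinearMap.sub_apply] at h
  simp only [LinearMap.smul_apply, bilin_apply, two_form_self, smul_eq_mul] at h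
  rw [wedge_apply]
  simp only [Matrix.cons_val_zero, Matrix.cons_val_one, contract_apply]
  rw [two_form_swap Φ u e] at h
  linarith

theorem exists_apply_eq_one {θ : V [⋀^Fin 1]→L[ℝ] ℝ} {u : V} (hu : θ ![u] ≠ 0) :
    θ ![(θ ![u])⁻¹ • u] = 1 := by
  rw [← lin_apply, map_smul, lin_apply, smul_eq_mul, inv_mul_cancel₀ hu]

/-- Reindexing by right multiplication with the transposition changes every sign and keeps `F`, so
the sum equals its negative. -/
theorem sum_sign_mul_eq_zero {F : Equiv.Perm (Fin 5) → ℝ} {i j : Fin 5} (hij : i ≠ j)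
    (hF : ∀ σ, F (σ * Equiv.swap i j) = F σ) :
    ∑ σ : Equiv.Perm (Fin 5), ((Equiv.Perm.sign σ : ℤ) : ℝ) * F σ = 0 := by
  have h := Equiv.sum_comp (Equiv.mulRight (Equiv.swap i j))
    (fun σ : Equiv.Perm (Fin 5) => ((Equiv.Perm.sign σ : ℤ) : ℝ) * F σ)
  simp only [Equiv.coe_mulRight, hF, Equiv.Perm.sign_mul, Equiv.Perm.sign_swap hij] at h
  simp only [Units.val_neg, Int.cast_neg, mul_neg, mul_one, neg_mul, Finset.sum_neg_distrib] at h
  linarith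

/-- Each of the two terms of θ ∧ b contributes a second factor θ, and the summand is symmetric under
exchanging the two slots filled by θ. -/
theorem wedge₁₂₂_wedge_left (θ b : V [⋀^Fin 1]→L[ℝ] ℝ) (Φ : V [⋀^Fin 2]→L[ℝ] ℝ)
    (v : Fin 5 → V) : wedge₁₂₂ θ (wedge θ b) Φ v = 0 := by
  have h1 := sum_sign_mul_eq_zero (i := 0) (j := 1) (by decide)
    (F := fun σ => θ ![v (σ 0)] * (θ ![v (σ 1)] * b ![v (σ 2)]) * Φ ![v (σ 3), v (σ 4)]) (by
      intro σ
      simp [Equiv.swap_apply_of_ne_of_ne]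
      exact Or.inl (by ring))
  have h2 := sum_sign_mul_eq_zero (i := 0) (j := 2) (by decide)
    (F := fun σ => θ ![v (σ 0)] * (θ ![v (σ 2)] * b ![v (σ 1)]) * Φ ![v (σ 3), v (σ 4)]) (by
      intro σ
      simp [Equiv.swap_apply_of_ne_of_ne]
      exact Or.inl (by ring))
  have h3 := congrArg₂ (· - ·) h1 h2
  simp only [← Finset.sum_sub_distrib, sub_zero] at h3
  rw [wedge₁₂₂, ← mul_zero (1 / 4 : ℝ), ← h3]
  congr 1
  refine Finset.sum_congr rfl fun σ _ => ?_
  rw [wedge_apply]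
  simp only [Matrix.cons_val_zero, Matrix.cons_val_one]
  ring

theorem wedge₁₂₂_wedge_right (θ b : V [⋀^Fin 1]→L[ℝ] ℝ) (Φ : V [⋀^Fin 2]→L[ℝ] ℝ)
    (v : Fin 5 → V) : wedge₁₂₂ θ Φ (wedge θ b) v = 0 := by
  have h1 := sum_sign_mul_eq_zero (i := 0) (j := 3) (by decide)
    (F := fun σ => θ ![v (σ 0)] * Φ ![v (σ 1), v (σ 2)] * (θ ![v (σ 3)] * b ![v (σ 4)])) (by
      intro σ
      simp [Equiv.swap_apply_of_ne_of_ne]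
      ring)
  have h2 := sum_sign_mul_eq_zero (i := 0) (j := 4) (by decide)
    (F := fun σ => θ ![v (σ 0)] * Φ ![v (σ 1), v (σ 2)] * (θ ![v (σ 4)] * b ![v (σ 3)])) (by
      intro σ
      simp [Equiv.swap_apply_of_ne_of_ne]
      ring)
  have h3 := congrArg₂ (· - ·) h1 h2
  simp only [← Finset.sum_sub_distrib, sub_zero] at h3
  rw [wedge₁₂₂, ← mul_zero (1 / 4 : ℝ), ← h3]
  congr 1
  refine Finset.sum_congr rfl fun σ _ => ?_
  rw [wedge_apply]
  simp only [Matrix.cons_val_zero, Matrix.cons_val_one]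
  ring

theorem wedge₁₂₂_comb_left (θ : V [⋀^Fin 1]→L[ℝ] ℝ) (c : ℝ) (Φ Φ' Ψ : V [⋀^Fin 2]→L[ℝ] ℝ)
    (v : Fin 5 → V) :
    wedge₁₂₂ θ (c • Φ + Φ') Ψ v = c * wedge₁₂₂ θ Φ Ψ v + wedge₁₂₂ θ Φ' Ψ v := by
  simp only [wedge₁₂₂, Finset.mul_sum, ← Finset.sum_add_distrib]
  refine Finset.sum_congr rfl fun σ _ => ?_
  simp only [ContinuousAlternatingMap.add_apply, ContinuousAlternatingMap.smul_apply, smul_eq_mul]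
  ring

theorem wedge₁₂₂_comb_right (θ : V [⋀^Fin 1]→L[ℝ] ℝ) (c : ℝ) (Φ Φ' Ψ : V [⋀^Fin 2]→L[ℝ] ℝ)
    (v : Fin 5 → V) :
    wedge₁₂₂ θ Ψ (c • Φ + Φ') v = c * wedge₁₂₂ θ Ψ Φ v + wedge₁₂₂ θ Ψ Φ' v := by
  simp only [wedge₁₂₂, Finset.mul_sum, ← Finset.sum_add_distrib]
  refine Finset.sum_congr rfl fun σ _ => ?_
  simp only [ContinuousAlternatingMap.add_apply, ContinuousAlternatingMap.smul_apply, smul_eq_mul]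
  ring

/-- Adding a multiple of `θ` to `Φ` does not change `θ ∧ Φ ∧ Φ`. -/
theorem wedge₁₂₂_comb_wedge (θ b : V [⋀^Fin 1]→L[ℝ] ℝ) (c : ℝ) (Φ : V [⋀^Fin 2]→L[ℝ] ℝ)
    (v : Fin 5 → V) :
    wedge₁₂₂ θ (c • Φ + wedge θ b) (c • Φ + wedge θ b) v = c ^ 2 * wedge₁₂₂ θ Φ Φ v := by
  rw [wedge₁₂₂_comb_left, wedge₁₂₂_comb_right, wedge₁₂₂_wedge_left, wedge₁₂₂_wedge_right]
  ring

theorem smul_wedge (c : ℝ) (θ b : V [⋀^Fin 1]→L[ℝ] ℝ) : c • wedge θ b = wedge θ (c • b) :=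
  two_form_ext fun u w => by
    simp only [wedge_apply, ContinuousAlternatingMap.smul_apply, smul_eq_mul]; ring

/-- In a hyperbolic pencil the second generator is not congruent to a multiple of the first. -/
theorem not_wedge_of_hyperbolic {θ : V [⋀^Fin 1]→L[ℝ] ℝ} {Φ Ψ : V [⋀^Fin 2]→L[ℝ] ℝ}
    (hc : ∃ v, wedge₁₂₂ θ Φ Φ v ≠ 0)
    (hh : ∃ s t s' t' : ℝ, s * t' - s' * t ≠ 0 ∧
      (∀ v, wedge₁₂₂ θ (s • Φ + t • Ψ) (s • Φ + t • Ψ) v = 0) ∧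
      (∀ v, wedge₁₂₂ θ (s' • Φ + t' • Ψ) (s' • Φ + t' • Ψ) v = 0)) (κ : ℝ)
    (b : V [⋀^Fin 1]→L[ℝ] ℝ) : Ψ ≠ κ • Φ + wedge θ b := by
  rintro rfl
  obtain ⟨v, hv⟩ := hc
  obtain ⟨s, t, s', t', hne, h1, h2⟩ := hh
  -- If Ψ ≡ κΦ mod θ, the quadratic form of the pencil is (s + tκ)² times a nonzero value, so it has
  -- a double root.
  have key : ∀ s t : ℝ, (∀ v, wedge₁₂₂ θ (s • Φ + t • (κ • Φ + wedge θ b))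
      (s • Φ + t • (κ • Φ + wedge θ b)) v = 0) → s + t * κ = 0 := by
    intro s t h
    have h3 := h v
    have h4 : s • Φ + t • (κ • Φ + wedge θ b) = (s + t * κ) • Φ + wedge θ (t • b) := by
      rw [← smul_wedge]; module
    rw [h4, wedge₁₂₂_comb_wedge] at h3
    exact pow_eq_zero_iff (two_ne_zero) |>.1 ((mul_eq_zero.1 h3).resolve_right hv)
  have e1 := key s t h1
  have e2 := key s' t' h2
  apply hne
  linear_combination t' * e1 - t * e2

variable {n : ℕ} {h : Fin n → V [⋀^Fin 1]→L[ℝ] ℝ} {e : Fin n → V}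

/-- A `2`-form that vanishes on all but one of the vectors of a frame vanishes on the kernel of
the corresponding covector. -/
theorem vanish_ker_of_vanish_frame [FiniteDimensional ℝ V] (hn : Module.finrank ℝ V = n)
    (hd : ∀ i j, h i ![e j] = if i = j then 1 else 0) {Φ : V [⋀^Fin 2]→L[ℝ] ℝ} {i₀ : Fin n}
    (hΦ : ∀ a b, a ≠ i₀ → b ≠ i₀ → Φ ![e a, e b] = 0) {u w : V}
    (hu : h i₀ ![u] = 0) (hw : h i₀ ![w] = 0) : Φ ![u, w] = 0 := by
  rw [eq_sum_of_dual hn hd u, eq_sum_of_dual hn hd w, ← bilin_apply]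
  simp only [map_sum, LinearMap.sum_apply]
  refine Finset.sum_eq_zero fun j _ => Finset.sum_eq_zero fun i _ => ?_
  rw [map_smul, map_smul, LinearMap.smul_apply, bilin_apply]
  by_cases hi : i = i₀
  · subst hi; rw [hu]; simp
  by_cases hj : j = i₀
  · subst hj; rw [hw]; simp
  rw [hΦ i j hi hj]; simp

end Pointwise
-- One of the two Monge-Ampère systems, pulled back to B.
section Half

open Filter

/-- The pairing of the indices `2, 3` and `4, 5`, fixing `0` and `1`. -/
def partner : Fin 6 → Fin 6 := ![0, 1, 3, 2, 5, 4]

/-- The indices `a` and `b` belong to different pairs. -/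
abbrev Mixed (a b : Fin 6) : Prop := 2 ≤ a ∧ 2 ≤ b ∧ b ≠ a ∧ b ≠ partner a

theorem two_le_partner : ∀ {a : Fin 6}, 2 ≤ a → 2 ≤ partner a := by decide

theorem partner_partner : ∀ a : Fin 6, partner (partner a) = a := by decide

theorem partner_ne_partner : ∀ {a b : Fin 6}, b ≠ a → partner a ≠ partner b := by decide

theorem Mixed.partner_left : ∀ {a b : Fin 6}, Mixed a b → Mixed (partner a) b := by decide

theorem Mixed.symm : ∀ {a b : Fin 6}, Mixed a b → Mixed b a := by decide

theorem Mixed.cover : ∀ {a b : Fin 6}, Mixed a b → ∀ c, 2 ≤ c →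
    c = a ∨ c = partner a ∨ c = b ∨ c = partner b := by decide

variable {m n k : ℕ}
  {M : Type*} [TopologicalSpace M] [ChartedSpace (EuclideanSpace ℝ (Fin n)) M]
  {N : Type*} [TopologicalSpace N] [ChartedSpace (EuclideanSpace ℝ (Fin m)) N]

theorem Form.pullback_apply₁ (f : M → N) (α : Form m N 1) (x : M) (u : TangentSpace (𝓡 n) x) :
    Form.pullback (n := n) f α x ![u] = α (f x) ![mfderiv (𝓡 n) (𝓡 m) f x u] := by
  refine congrArg (α (f x)) (funext fun i => ?_)
  fin_cases i; rfl

theorem Form.pullback_apply₂ (f : M → N) (α : Form m N 2) (x : M) (u w : TangentSpace (𝓡 n) x) :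
    Form.pullback (n := n) f α x ![u, w] =
      α (f x) ![mfderiv (𝓡 n) (𝓡 m) f x u, mfderiv (𝓡 n) (𝓡 m) f x w] := by
  refine congrArg (α (f x)) (funext fun i => ?_)
  fin_cases i <;> rfl

variable {B : Type*} [TopologicalSpace B] [ChartedSpace (EuclideanSpace ℝ (Fin 6)) B]
  {U : Set B} (η : Coframing U)

instance (x : M) : FiniteDimensional ℝ (TangentSpace (𝓡 n) x) :=
  inferInstanceAs (FiniteDimensional ℝ (EuclideanSpace ℝ (Fin n)))

theorem finrank_tangentSpace (x : M) : Module.finrank ℝ (TangentSpace (𝓡 n) x) = n :=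
  finrank_euclideanSpace_fin (𝕜 := ℝ)

namespace Coframing

theorem expand {x : B} (hx : x ∈ U) (v : TangentSpace (𝓡 6) x) :
    v = ∑ i, η.form i x ![v] • η.vec i x :=
  eq_sum_of_dual (finrank_tangentSpace x)
    (h := fun i => η.form i x) (e := fun i => η.vec i x) (η.dual x hx) v

theorem vanish_ker {x : B} (hx : x ∈ U) {Φ : TangentSpace (𝓡 6) x [⋀^Fin 2]→L[ℝ] ℝ} {i₀ : Fin 6}
    (hΦ : ∀ a b, a ≠ i₀ → b ≠ i₀ → Φ ![η.vec a x, η.vec b x] = 0) {u w : TangentSpace (𝓡 6) x}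
    (hu : η.form i₀ x ![u] = 0) (hw : η.form i₀ x ![w] = 0) : Φ ![u, w] = 0 :=
  vanish_ker_of_vanish_frame (finrank_tangentSpace x)
    (h := fun i => η.form i x) (e := fun i => η.vec i x) (η.dual x hx) hΦ hu hw

/-- Modulo the covector with index `i₀`, the `2`-form `Φ` is a combination of `ω¹ ∧ ω²` and
`ω³ ∧ ω⁴`. -/
def Paired (i₀ : Fin 6) (x : B) (Φ : TangentSpace (𝓡 6) x [⋀^Fin 2]→L[ℝ] ℝ) : Prop :=
  ∀ a b, a ≠ i₀ → b ≠ i₀ → b ≠ partner a → Φ ![η.vec a x, η.vec b x] = 0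

variable {N : Type*} [TopologicalSpace N] [ChartedSpace (EuclideanSpace ℝ (Fin 5)) N]

/-- The coframing is adapted to one Monge-Ampère system, pulled back from `N`, whose contact form
has index `i₀`. -/
structure IsAdaptedTo (I : IdealField 5 N) (π : B → N) (i₀ i₁ : Fin 6) : Prop where
  index : (i₀ = 0 ∧ i₁ = 1) ∨ (i₀ = 1 ∧ i₁ = 0)
  mongeAmpere : IsHyperbolicMongeAmpere I
  smooth_map : ContMDiff (𝓡 6) (𝓡 5) ∞ π
  submersion : ∀ x, Function.Surjective (mfderiv (𝓡 6) (𝓡 5) π x)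
  contact : ∀ x ∈ U, (IdealField.pullback (n := 6) π I x).deg1 = Submodule.span ℝ {η.form i₀ x}
  mixed : ∀ x ∈ U, ∀ Φ ∈ (IdealField.pullback (n := 6) π I x).deg2, ∀ a b, Mixed a b →
    Φ ![η.vec a x, η.vec b x] = 0
  paired_d : ∀ x ∈ U, η.Paired i₀ x ((η.form i₀).d x)
  d_ne : ∀ x ∈ U, ∀ a, 2 ≤ a → η.coeff i₀ (partner a) a x ≠ 0

theorem pullback_mem_deg2 {I : IdealField 5 N} {π : B → N} {x : B} {Φ : Form 5 N 2}
    (hΦ : Φ (π x) ∈ (I (π x)).deg2) :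
    Form.pullback (n := 6) π Φ x ∈ (IdealField.pullback (n := 6) π I x).deg2 :=
  Submodule.subset_span (Or.inr ⟨Φ (π x), hΦ, rfl⟩)

variable {η} {I : IdealField 5 N} {π : B → N} {i₀ i₁ : Fin 6} (hη : η.IsAdaptedTo I π i₀ i₁)
include hη

namespace IsAdaptedTo

theorem eq_or_two_le {a : Fin 6} (ha : a ≠ i₀) : a = i₁ ∨ 2 ≤ a := by
  rcases hη.index with ⟨rfl, rfl⟩ | ⟨rfl, rfl⟩ <;> revert a <;> decide

theorem ne_index {a : Fin 6} (ha : 2 ≤ a) : a ≠ i₀ := by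
  rcases hη.index with ⟨rfl, rfl⟩ | ⟨rfl, rfl⟩ <;> revert a <;> decide

theorem ne_index' {a : Fin 6} (ha : 2 ≤ a) : a ≠ i₁ := by
  rcases hη.index with ⟨rfl, rfl⟩ | ⟨rfl, rfl⟩ <;> revert a <;> decide

theorem index_ne : i₁ ≠ i₀ := by
  rcases hη.index with ⟨rfl, rfl⟩ | ⟨rfl, rfl⟩ <;> decide

theorem partner_index : partner i₁ = i₁ := by
  rcases hη.index with ⟨rfl, rfl⟩ | ⟨rfl, rfl⟩ <;> decide

theorem contMDiffAt (x : B) : ContMDiffAt (𝓡 6) (𝓡 5) 2 π x :=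
  (hη.smooth_map x).of_le ENat.LEInfty.out

/-- Both covectors span the degree 1 part of the pulled back ideal, and the coframing covector is
nonzero. The factor is found pointwise, with no regularity in `x`. -/
theorem exists_scale {W : Set N} {θ : Form 5 N 1} {Ψ : Form 5 N 2}
    (hW : IsMongeAmpereGenerator I W θ Ψ) {x : B} (hx : x ∈ U) (hxW : π x ∈ W) :
    ∃ f : ℝ, f ≠ 0 ∧ Form.pullback (n := 6) π θ x = f • η.form i₀ x := by
  have h1 := hη.contact x hx
  have h2 : (IdealField.pullback (n := 6) π I x).deg1 =
      Submodule.span ℝ {Form.pullback (n := 6) π θ x} := by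
    have h3 : (I (π x)).deg1 = Submodule.span ℝ {θ (π x)} := by
      rw [hW.generates _ hxW]; rfl
    refine le_antisymm (Submodule.span_le.2 ?_) (Submodule.span_le.2 ?_)
    · rintro _ ⟨a, ha, rfl⟩
      rw [h3] at ha
      obtain ⟨c, rfl⟩ := Submodule.mem_span_singleton.1 ha
      exact Submodule.mem_span_singleton.2 ⟨c, rfl⟩
    · rintro _ rfl
      refine Submodule.subset_span ⟨θ (π x), ?_, rfl⟩
      rw [h3]; exact Submodule.mem_span_singleton_self _
  rw [h2] at h1
  obtain ⟨f, hf⟩ := Submodule.mem_span_singleton.1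
    (h1 ▸ Submodule.mem_span_singleton_self (Form.pullback (n := 6) π θ x))
  refine ⟨f, ?_, hf.symm⟩
  rintro rfl
  rw [zero_smul] at hf
  rw [← hf] at h1
  have h4 : η.form i₀ x ∈ Submodule.span ℝ {(0 : TangentSpace (𝓡 6) x [⋀^Fin 1]→L[ℝ] ℝ)} := by
    rw [h1]; exact Submodule.mem_span_singleton_self _
  rw [Submodule.span_zero_singleton, Submodule.mem_bot] at h4
  have h5 := η.dual x hx i₀ i₀
  rw [h4] at h5
  simp at h5

variable [IsManifold (𝓡 6) ∞ B] [IsManifold (𝓡 5) ∞ N]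

/-- Formally π^*dθ = d(f η) ≡ f dη modulo η, where η is the covector with index `i₀`. The factor f
is never differentiated, since π^*θ vanishes identically on the two frame vectors. -/
theorem pullback_d_vec (hU : IsOpen U) {W : Set N} {θ : Form 5 N 1} {Ψ : Form 5 N 2}
    (hW : IsMongeAmpereGenerator I W θ Ψ) {x : B} (hx : x ∈ U) (hxW : π x ∈ W) {f : ℝ}
    (hfx : Form.pullback (n := 6) π θ x = f • η.form i₀ x) {a b : Fin 6} (ha : a ≠ i₀)
    (hb : b ≠ i₀) : Form.pullback (n := 6) π θ.d x ![η.vec a x, η.vec b x] =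
      f * η.coeff i₀ a b x := by
  have hev : ∀ᶠ y in 𝓝 x, y ∈ U ∧ π y ∈ W := (hU.eventually_mem hx).and
    ((hη.smooth_map.continuous.tendsto x).eventually (hW.isOpen.mem_nhds hxW))
  have hvan : ∀ a, a ≠ i₀ → ∀ᶠ y in 𝓝 x, Form.pullback (n := 6) π θ y ![η.vec a y] = 0 := by
    intro a ha
    filter_upwards [hev] with y hy
    obtain ⟨g, _, hg⟩ := hη.exists_scale hW hy.1 hy.2
    rw [hg, ContinuousAlternatingMap.smul_apply, η.dual y hy.1, if_neg ha.symm, smul_zero]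
  rw [← Form.d_pullback (hη.contMDiffAt x) (hW.smooth_theta.diffAt hxW),
    η.d_of_vanish₁ hU hx (Form.differentiableAt_coord_pullback (hη.contMDiffAt x)
      (hW.smooth_theta.diffAt hxW)) (hvan a ha) (hvan b hb), hfx,
    Finset.sum_eq_single i₀]
  · rw [ContinuousAlternatingMap.smul_apply, η.dual x hx]; simp
  · intro i _ hi
    rw [ContinuousAlternatingMap.smul_apply, η.dual x hx, if_neg hi.symm]; simp
  · simp

/-- The projection contracts the frame vector dual to the other contact form. -/
theorem mfderiv_vec (hU : IsOpen U) {x : B} (hx : x ∈ U) :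
    mfderiv (𝓡 6) (𝓡 5) π x (η.vec i₁ x) = 0 := by
  obtain ⟨W, θ, Ψ, hxW, hW⟩ := hη.mongeAmpere (π x)
  obtain ⟨f, hf, hfx⟩ := hη.exists_scale hW hx hxW
  have hd := fun a b => hη.pullback_d_vec hU hW hx hxW hfx (a := a) (b := b)
  -- A kernel vector exists because the dimension drops from 6 to 5. All its components except the
  -- one along `i₁` are then shown to vanish.
  obtain ⟨v, hv, hv0⟩ := (Submodule.ne_bot_iff _).1 (LinearMap.ker_ne_bot_of_finrank_lt
    (f := (mfderiv (𝓡 6) (𝓡 5) π x : TangentSpace (𝓡 6) x →ₗ[ℝ] TangentSpace (𝓡 5) (π x)))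
    (by rw [finrank_tangentSpace, finrank_tangentSpace]; norm_num))
  replace hv : mfderiv (𝓡 6) (𝓡 5) π x v = 0 := hv
  have hcomp : ∀ a, a ≠ i₁ → η.form a x ![v] = 0 := by
    have h0 : η.form i₀ x ![v] = 0 := by
      have h := Form.pullback_apply₁ (n := 6) π θ x v
      rw [hv, hfx, ContinuousAlternatingMap.smul_apply, ← lin_apply (θ (π x)), map_zero] at h
      exact (smul_eq_zero.1 h).resolve_left hf
    intro a ha
    by_cases hai : a = i₀
    · rw [hai, h0]
    have ha2 : 2 ≤ a := (hη.eq_or_two_le hai).resolve_left ha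
    have h := Form.pullback_apply₂ (n := 6) π θ.d x v (η.vec (partner a) x)
    have hp2 : 2 ≤ partner a := two_le_partner ha2
    have hpi : partner a ≠ i₀ := hη.ne_index hp2
    rw [hv, ← bilin_apply (θ.d (π x)), map_zero, LinearMap.zero_apply, η.expand hx v,
      -- Pairing `v` with `vec (partner a)` through π^*dθ isolates the component of `v` along `a`,
      -- as dθ pairs each ω-direction only with its partner.
      ← bilin_apply, map_sum, LinearMap.sum_apply, Finset.sum_eq_single a] at h
    · rw [map_smul, LinearMap.smul_apply, bilin_apply, hd _ _ hai hpi, smul_eq_mul] at h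
      have hne := hη.d_ne x hx (partner a) hp2
      rw [partner_partner] at hne
      exact (mul_eq_zero.1 h).resolve_right (mul_ne_zero hf hne)
    · intro i _ hia
      rw [map_smul, LinearMap.smul_apply, bilin_apply]
      by_cases hi : i = i₀
      · rw [hi, h0, zero_smul]
      · rw [hd _ _ hi hpi]
        have : η.coeff i₀ i (partner a) x = 0 := hη.paired_d x hx i _ hi hpi
          (partner_ne_partner hia)
        rw [this, mul_zero, smul_zero]
    · simp
  have hv1 : v = η.form i₁ x ![v] • η.vec i₁ x := by
    conv_lhs => rw [η.expand hx v]
    refine Finset.sum_eq_single i₁ (fun i _ hi => ?_) (by simp)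
    rw [hcomp i hi, zero_smul]
  have hne : η.form i₁ x ![v] ≠ 0 := by
    intro h0
    rw [h0, zero_smul] at hv1
    exact hv0 hv1
  rw [hv1, map_smul] at hv
  exact (smul_eq_zero.1 hv).resolve_left hne

theorem pullback_apply_vec (hU : IsOpen U) {x : B} (hx : x ∈ U) (Φ : Form 5 N 2)
    (w : TangentSpace (𝓡 6) x) : Form.pullback (n := 6) π Φ x ![η.vec i₁ x, w] = 0 := by
  rw [Form.pullback_apply₂, hη.mfderiv_vec hU hx, ← bilin_apply, map_zero, LinearMap.zero_apply]

/-- Entries involving `i₁` vanish on generators: pullbacks are killed by the fibre direction, and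
multiples of the contact covector vanish on both vectors. The remaining entries are the mixed ones.
-/
theorem paired_of_mem (hU : IsOpen U) {x : B} (hx : x ∈ U)
    {Φ : TangentSpace (𝓡 6) x [⋀^Fin 2]→L[ℝ] ℝ}
    (hΦ : Φ ∈ (IdealField.pullback (n := 6) π I x).deg2) : η.Paired i₀ x Φ := by
  have hker : ∀ b, b ≠ i₀ → Φ ![η.vec i₁ x, η.vec b x] = 0 := by
    intro b hb
    obtain ⟨W, θ, Ψ, hxW, hW⟩ := hη.mongeAmpere (π x)
    refine Submodule.span_induction (p := fun Φ _ => Φ ![η.vec i₁ x, η.vec b x] = 0) ?_ ?_ ?_ ?_ hΦ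
    · rintro Φ (⟨a, ha, c, rfl⟩ | ⟨Φ, -, rfl⟩)
      · have ha' := Submodule.subset_span (R := ℝ) ha
        change a ∈ (IdealField.pullback (n := 6) π I x).deg1 at ha'
        rw [hη.contact x hx] at ha'
        obtain ⟨r, rfl⟩ := Submodule.mem_span_singleton.1 ha'
        rw [wedge_apply]
        simp only [Matrix.cons_val_zero, Matrix.cons_val_one,
          ContinuousAlternatingMap.smul_apply, η.dual x hx, if_neg hη.index_ne.symm, if_neg hb.symm]
        simp
      · exact Φ.map_coord_zero (0 : Fin 2) (hη.mfderiv_vec hU hx)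
    · simp
    · intro Φ Ψ _ _ h1 h2
      rw [ContinuousAlternatingMap.add_apply, h1, h2, add_zero]
    · intro c Φ _ h1
      rw [ContinuousAlternatingMap.smul_apply, h1, smul_zero]
  intro a b ha hb hab
  rcases hη.eq_or_two_le ha with rfl | ha2
  · exact hker b hb
  rcases hη.eq_or_two_le hb with rfl | hb2
  · rw [two_form_swap, hker a ha, neg_zero]
  by_cases hba : b = a
  · rw [hba, two_form_self]
  exact hη.mixed x hx Φ hΦ a b ⟨ha2, hb2, hba, hab⟩

/-- The fibre direction kills d(π^*Φ) = π^*dΦ. Evaluating on (e_{i₁}, e_a, e_b) with `a`, `b` in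
different pairs leaves one unknown structure coefficient for each of the two components of Φ. -/
theorem coeff_relation (hU : IsOpen U) {x : B} (hx : x ∈ U) {Φ : Form 5 N 2}
    (hd : Φ.DiffAt (π x)) (hΦ : ∀ᶠ y in 𝓝 x, Φ (π y) ∈ (I (π y)).deg2) {a b : Fin 6}
    (hab : Mixed a b) :
    η.coeff (partner b) i₁ a x *
        Form.pullback (n := 6) π Φ x ![η.vec (partner b) x, η.vec b x] +
      η.coeff (partner a) b i₁ x *
        Form.pullback (n := 6) π Φ x ![η.vec (partner a) x, η.vec a x] = 0 := by
  have hp : ∀ᶠ y in 𝓝 x, η.Paired i₀ y (Form.pullback (n := 6) π Φ y) := by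
    filter_upwards [hΦ, hU.eventually_mem hx] with y hy hyU
    exact hη.paired_of_mem hU hyU (pullback_mem_deg2 hy)
  have ha := hη.ne_index hab.1
  have hb := hη.ne_index hab.2.1
  have hpx := hp.self_of_nhds
  have key := η.d_of_vanish₂ hU hx (a := i₁) (b := a) (d := b)
    (Form.differentiableAt_coord_pullback (hη.contMDiffAt x) hd)
    (by filter_upwards [hp] with y hy using hy a b ha hb hab.2.2.2)
    (by filter_upwards [hU.eventually_mem hx] with y hy using hη.pullback_apply_vec hU hy Φ _)
    (by filter_upwards [hU.eventually_mem hx] with y hy using hη.pullback_apply_vec hU hy Φ _)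
  have h0 : (Form.pullback (n := 6) π Φ).d x ![η.vec i₁ x, η.vec a x, η.vec b x] = 0 := by
    rw [Form.d_pullback (hη.contMDiffAt x) hd]
    refine (Φ.d (π x)).map_coord_zero (0 : Fin 3) ?_
    exact hη.mfderiv_vec hU hx
  have hd1 : ∀ c, 2 ≤ c → η.coeff i₀ i₁ c x = 0 := fun c hc =>
    hη.paired_d x hx i₁ c hη.index_ne (hη.ne_index hc) (by
      rw [hη.partner_index]; exact hη.ne_index' hc)
  have hd2 : ∀ c, 2 ≤ c → η.coeff i₀ c i₁ x = 0 := fun c hc => by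
    rw [coeff, two_form_swap, ← coeff, hd1 c hc, neg_zero]
  rw [h0, Finset.sum_add_distrib, Finset.sum_add_distrib,
    Finset.sum_eq_single (f := fun i => η.coeff i i₁ a x * _) (partner b),
    Finset.sum_eq_zero (f := fun i => η.coeff i a b x * _),
    Finset.sum_eq_single (f := fun i => η.coeff i b i₁ x * _) (partner a), add_zero] at key
  · exact key.symm
  · intro i _ hi
    by_cases hi0 : i = i₀
    · rw [hi0, hd2 b hab.2.1, zero_mul]
    · rw [hpx i a hi0 ha (fun h => hi (by rw [h, partner_partner])), mul_zero]
  · simp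
  · intro i _
    rw [two_form_swap, hη.pullback_apply_vec hU hx, neg_zero, mul_zero]
  · intro i _ hi
    by_cases hi0 : i = i₀
    · rw [hi0, hd1 a hab.1, zero_mul]
    · rw [hpx i b hi0 hb (fun h => hi (by rw [h, partner_partner])), mul_zero]
  · simp

/-- The pullbacks of `dθ` and of `Ψ` have independent components along the two pairs. -/
theorem independent (hU : IsOpen U) {W : Set N} {θ : Form 5 N 1} {Ψ : Form 5 N 2}
    (hW : IsMongeAmpereGenerator I W θ Ψ) {x : B} (hx : x ∈ U) (hxW : π x ∈ W) {a b : Fin 6}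
    (hab : Mixed a b) :
    Form.pullback (n := 6) π θ.d x ![η.vec (partner a) x, η.vec a x] *
        Form.pullback (n := 6) π Ψ x ![η.vec (partner b) x, η.vec b x] -
      Form.pullback (n := 6) π θ.d x ![η.vec (partner b) x, η.vec b x] *
        Form.pullback (n := 6) π Ψ x ![η.vec (partner a) x, η.vec a x] ≠ 0 := by
  intro hdet
  obtain ⟨f, hf, hfx⟩ := hη.exists_scale hW hx hxW
  have hp : Form.pullback (n := 6) π θ.d x ![η.vec (partner a) x, η.vec a x] ≠ 0 := by
    rw [hη.pullback_d_vec hU hW hx hxW hfx (hη.ne_index (two_le_partner hab.1))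
      (hη.ne_index hab.1)]
    exact mul_ne_zero hf (hη.d_ne x hx a hab.1)
  set Θ := Form.pullback (n := 6) π θ.d x with hΘ
  set Φ := Form.pullback (n := 6) π Ψ x with hΦ
  -- κ matches the components of Ψ and dθ along the first pair; the vanishing determinant makes it
  -- match along the second. Then Ψ ≡ κ dθ modulo θ, against hyperbolicity.
  set κ := Φ ![η.vec (partner a) x, η.vec a x] / Θ ![η.vec (partner a) x, η.vec a x] with hκ
  have hpΘ : η.Paired i₀ x Θ := hη.paired_of_mem hU hx (pullback_mem_deg2 (by
    rw [hW.generates _ hxW]; exact Submodule.subset_span (Or.inr (Or.inl rfl))))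
  have hpΦ : η.Paired i₀ x Φ := hη.paired_of_mem hU hx (pullback_mem_deg2 (by
    rw [hW.generates _ hxW]; exact Submodule.subset_span (Or.inr (Or.inr rfl))))
  have hpair : ∀ c, 2 ≤ c → Φ ![η.vec (partner c) x, η.vec c x] =
      κ * Θ ![η.vec (partner c) x, η.vec c x] := by
    have ha : Φ ![η.vec (partner a) x, η.vec a x] = κ * Θ ![η.vec (partner a) x, η.vec a x] := by
      rw [hκ, div_mul_cancel₀ _ hp]
    have hb : Φ ![η.vec (partner b) x, η.vec b x] = κ * Θ ![η.vec (partner b) x, η.vec b x] := by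
      rw [hκ, div_mul_eq_mul_div, eq_div_iff hp]
      linarith
    intro c hc
    rcases hab.cover c hc with rfl | rfl | rfl | rfl
    · exact ha
    · rw [partner_partner, two_form_swap Φ, two_form_swap Θ, ha, mul_neg]
    · exact hb
    · rw [partner_partner, two_form_swap Φ, two_form_swap Θ, hb, mul_neg]
  have hvan : ∀ c d, c ≠ i₀ → d ≠ i₀ → (Φ - κ • Θ) ![η.vec c x, η.vec d x] = 0 := by
    intro c d hc hd
    rw [ContinuousAlternatingMap.sub_apply, ContinuousAlternatingMap.smul_apply, smul_eq_mul]
    by_cases hcd : d = partner c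
    · rcases hη.eq_or_two_le hd with rfl | hd2
      · have : c = d := by rw [← hη.partner_index, hcd, partner_partner]
        rw [this, two_form_self, two_form_self]; ring
      · have : c = partner d := by rw [hcd, partner_partner]
        rw [this, hpair d hd2, sub_self]
    · rw [hpΦ c d hc hd hcd, hpΘ c d hc hd hcd]; ring
  -- The congruence descends to N because tangent vectors there lift through the submersion, and
  -- vectors of ker θ lift to the kernel of the contact covector.
  have hker : ∀ u w, θ (π x) ![u] = 0 → θ (π x) ![w] = 0 →
      (Ψ (π x) - κ • θ.d (π x)) ![u, w] = 0 := by
    intro u w hu hw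
    obtain ⟨u, rfl⟩ := hη.submersion x u
    obtain ⟨w, rfl⟩ := hη.submersion x w
    have hlift : ∀ v, θ (π x) ![mfderiv (𝓡 6) (𝓡 5) π x v] = 0 → η.form i₀ x ![v] = 0 := by
      intro v hv
      rw [← Form.pullback_apply₁, hfx, ContinuousAlternatingMap.smul_apply] at hv
      exact (smul_eq_zero.1 hv).resolve_left hf
    have h := η.vanish_ker hx hvan (hlift u hu) (hlift w hw)
    rw [ContinuousAlternatingMap.sub_apply, ContinuousAlternatingMap.smul_apply, hΦ, hΘ,
      Form.pullback_apply₂, Form.pullback_apply₂] at h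
    exact h
  have hne : θ (π x) ![mfderiv (𝓡 6) (𝓡 5) π x (η.vec i₀ x)] ≠ 0 := by
    rw [← Form.pullback_apply₁, hfx, ContinuousAlternatingMap.smul_apply, η.dual x hx, if_pos rfl]
    simpa using hf
  have h := eq_wedge_contract (exists_apply_eq_one hne) hker
  exact not_wedge_of_hyperbolic (hW.contact _ hxW) (hW.hyperbolic _ hxW) κ _
    (sub_eq_iff_eq_add'.1 h)

/-- The characteristic systems of the Monge-Ampère system are projectable. -/
theorem coeff_eq_zero (hU : IsOpen U) {x : B} (hx : x ∈ U) {a b : Fin 6} (hab : Mixed a b) :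
    η.coeff a i₁ b x = 0 := by
  obtain ⟨W, θ, Ψ, hxW, hW⟩ := hη.mongeAmpere (π x)
  have hev : ∀ᶠ y in 𝓝 x, π y ∈ W :=
    (hη.smooth_map.continuous.tendsto x).eventually (hW.isOpen.mem_nhds hxW)
  -- With this choice of indices the first unknown in `coeff_relation` is `η.coeff a i₁ b x`. The
  -- relations for dθ and Ψ form a 2×2 homogeneous system with nonzero determinant.
  have h' : Mixed b (partner a) := hab.partner_left.symm
  have h1 := hη.coeff_relation hU hx ((hW.smooth_theta.d hW.isOpen).diffAt hxW) (by
    filter_upwards [hev] with y hy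
    rw [hW.generates _ hy]
    exact Submodule.subset_span (Or.inr (Or.inl rfl))) h'
  have h2 := hη.coeff_relation hU hx (hW.smooth_psi.diffAt hxW) (by
    filter_upwards [hev] with y hy
    rw [hW.generates _ hy]
    exact Submodule.subset_span (Or.inr (Or.inr rfl))) h'
  have h3 := hη.independent hU hW hx hxW h'
  rw [partner_partner] at h1 h2 h3
  refine (mul_eq_zero.1 ?_).resolve_right h3
  linear_combination Form.pullback (n := 6) π θ.d x ![η.vec (partner b) x, η.vec b x] * h2 -
    Form.pullback (n := 6) π Ψ x ![η.vec (partner b) x, η.vec b x] * h1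

/-- The `2`-forms in the pulled back ideal. -/
theorem mem_deg2_iff (hU : IsOpen U) {x : B} (hx : x ∈ U)
    {Φ : TangentSpace (𝓡 6) x [⋀^Fin 2]→L[ℝ] ℝ} :
    Φ ∈ (IdealField.pullback (n := 6) π I x).deg2 ↔ η.Paired i₀ x Φ := by
  refine ⟨hη.paired_of_mem hU hx, fun hΦ => ?_⟩
  obtain ⟨W, θ, Ψ, hxW, hW⟩ := hη.mongeAmpere (π x)
  have hdet := hη.independent hU hW hx hxW (a := 2) (b := 4) (by decide)
  obtain ⟨f, hf, hfx⟩ := hη.exists_scale hW hx hxW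
  have hmΘ : Form.pullback (n := 6) π θ.d x ∈ (IdealField.pullback (n := 6) π I x).deg2 :=
    pullback_mem_deg2 (by
      rw [hW.generates _ hxW]; exact Submodule.subset_span (Or.inr (Or.inl rfl)))
  have hmΨ : Form.pullback (n := 6) π Ψ x ∈ (IdealField.pullback (n := 6) π I x).deg2 :=
    pullback_mem_deg2 (by
      rw [hW.generates _ hxW]; exact Submodule.subset_span (Or.inr (Or.inr rfl)))
  have hpΘ := hη.paired_of_mem hU hx hmΘ
  have hpΨ := hη.paired_of_mem hU hx hmΨ
  set Θ := Form.pullback (n := 6) π θ.d x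
  set Ξ := Form.pullback (n := 6) π Ψ x
  obtain ⟨s, t, h2, h4⟩ : ∃ s t : ℝ,
      Φ ![η.vec (partner 2) x, η.vec 2 x] = s * Θ ![η.vec (partner 2) x, η.vec 2 x] +
        t * Ξ ![η.vec (partner 2) x, η.vec 2 x] ∧
      Φ ![η.vec (partner 4) x, η.vec 4 x] = s * Θ ![η.vec (partner 4) x, η.vec 4 x] +
        t * Ξ ![η.vec (partner 4) x, η.vec 4 x] := by
    generalize Θ ![η.vec (partner 2) x, η.vec 2 x] = p at *
    generalize Ξ ![η.vec (partner 2) x, η.vec 2 x] = p' at *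
    generalize Θ ![η.vec (partner 4) x, η.vec 4 x] = q at *
    generalize Ξ ![η.vec (partner 4) x, η.vec 4 x] = q' at *
    generalize Φ ![η.vec (partner 2) x, η.vec 2 x] = r at *
    generalize Φ ![η.vec (partner 4) x, η.vec 4 x] = r' at *
    -- Cramer's rule for the components along the two pairs.
    refine ⟨(r * q' - r' * p') / (p * q' - q * p'), (p * r' - q * r) / (p * q' - q * p'), ?_, ?_⟩
    · rw [div_mul_eq_mul_div, div_mul_eq_mul_div, ← add_div, eq_div_iff hdet]; ring
    · rw [div_mul_eq_mul_div, div_mul_eq_mul_div, ← add_div, eq_div_iff hdet]; ring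
  have hvan : ∀ c d, c ≠ i₀ → d ≠ i₀ → (Φ - (s • Θ + t • Ξ)) ![η.vec c x, η.vec d x] = 0 := by
    intro c d hc hd
    simp only [ContinuousAlternatingMap.sub_apply, ContinuousAlternatingMap.add_apply,
      ContinuousAlternatingMap.smul_apply, smul_eq_mul]
    by_cases hcd : d = partner c
    · have hcd' : c = partner d := by rw [hcd, partner_partner]
      rcases hη.eq_or_two_le hd with rfl | hd2
      · rw [hcd', hη.partner_index, two_form_self, two_form_self, two_form_self]; ring
      · rw [hcd']
        rcases (show Mixed 2 4 by decide).cover d hd2 with rfl | rfl | rfl | rfl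
        · linarith
        · rw [partner_partner, two_form_swap Φ, two_form_swap Θ, two_form_swap Ξ]; linarith
        · linarith
        · rw [partner_partner, two_form_swap Φ, two_form_swap Θ, two_form_swap Ξ]; linarith
    · rw [hΦ c d hc hd hcd, hpΘ c d hc hd hcd, hpΨ c d hc hd hcd]; ring
  have hw := eq_wedge_contract (e := η.vec i₀ x) (θ := η.form i₀ x)
    (by rw [η.dual x hx, if_pos rfl]) (fun u w => η.vanish_ker hx hvan)
  have hmem : Φ - (s • Θ + t • Ξ) ∈ (IdealField.pullback (n := 6) π I x).deg2 := by
    rw [hw]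
    refine Submodule.subset_span (Or.inl ⟨_, ⟨f⁻¹ • θ (π x), ?_, ?_⟩, _, rfl⟩)
    · rw [hW.generates _ hxW]
      exact Submodule.smul_mem _ _ (Submodule.subset_span rfl)
    · have h : f⁻¹ • Form.pullback (n := 6) π θ x = η.form i₀ x := by
        rw [hfx, smul_smul, inv_mul_cancel₀ hf, one_smul]
      exact h
  have := Submodule.add_mem _ hmem (Submodule.add_mem _ (Submodule.smul_mem _ s hmΘ)
    (Submodule.smul_mem _ t hmΨ))
  rwa [sub_add_cancel] at this

end IsAdaptedTo
end Coframing
end Half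
-- The two systems together: consequences of d² = 0.
section Structure

open Filter

namespace Coframing

variable {B : Type*} [TopologicalSpace B] [ChartedSpace (EuclideanSpace ℝ (Fin 6)) B]
  {U : Set B} {η : Coframing U}
  {M₁ : Type*} [TopologicalSpace M₁] [ChartedSpace (EuclideanSpace ℝ (Fin 5)) M₁]
  {M₂ : Type*} [TopologicalSpace M₂] [ChartedSpace (EuclideanSpace ℝ (Fin 5)) M₂]
  {I₁ : IdealField 5 M₁} {I₂ : IdealField 5 M₂} {ι : B → M₁ × M₂}

theorem wedge_apply_vec {x : B} (hx : x ∈ U) (i j a b : Fin 6) :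
    wedge (η.form i x) (η.form j x) ![η.vec a x, η.vec b x] =
      (if i = a then 1 else 0) * (if j = b then 1 else 0) -
        (if i = b then 1 else 0) * (if j = a then 1 else 0) := by
  rw [wedge_apply]
  simp only [Matrix.cons_val_zero, Matrix.cons_val_one, η.dual x hx]

/-- On generators: θ₁ and θ₂ kill both vectors, while each of ω¹∧ω² and ω³∧ω⁴ needs both arguments
from a single pair. -/
theorem IsZeroAdapted.apply_mixed (hη : η.IsZeroAdapted I₁ I₂ ι) {x : B} (hx : x ∈ U)
    {Φ : TangentSpace (𝓡 6) x [⋀^Fin 2]→L[ℝ] ℝ}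
    (hΦ : Φ ∈ ((ideal₁ I₁ ι x).sup (ideal₂ I₂ ι x)).deg2) {a b : Fin 6} (hab : Mixed a b) :
    Φ ![η.vec a x, η.vec b x] = 0 := by
  rw [hη.ideal x hx] at hΦ
  refine Submodule.span_induction (p := fun Φ _ => Φ ![η.vec a x, η.vec b x] = 0) ?_ ?_ ?_ ?_ hΦ
  · have hne : ∀ i : Fin 6, i < 2 → i ≠ a ∧ i ≠ b := by
      intro i hi
      constructor
      · rintro rfl; exact absurd hab.1 (not_le.2 hi)
      · rintro rfl; exact absurd hab.2.1 (not_le.2 hi)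
    rintro Φ (⟨c, (rfl | rfl), d, rfl⟩ | rfl | rfl)
    · rw [wedge_apply]
      simp only [Matrix.cons_val_zero, Matrix.cons_val_one]
      rw [η.dual x hx, η.dual x hx, if_neg (hne 0 (by decide)).1, if_neg (hne 0 (by decide)).2]
      ring
    · rw [wedge_apply]
      simp only [Matrix.cons_val_zero, Matrix.cons_val_one]
      rw [η.dual x hx, η.dual x hx, if_neg (hne 1 (by decide)).1, if_neg (hne 1 (by decide)).2]
      ring
    · rw [wedge_apply_vec hx]
      revert hab
      fin_cases a <;> fin_cases b <;> simp [Mixed, partner]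
    · rw [wedge_apply_vec hx]
      revert hab
      fin_cases a <;> fin_cases b <;> simp [Mixed, partner]
  · simp
  · intro Φ Ψ _ _ h1 h2
    rw [ContinuousAlternatingMap.add_apply, h1, h2, add_zero]
  · intro c Φ _ h1
    rw [ContinuousAlternatingMap.smul_apply, h1, smul_zero]

theorem paired_of_structure {x : B} (hx : x ∈ U) {i₀ : Fin 6} {r s : ℝ}
    {γ : TangentSpace (𝓡 6) x [⋀^Fin 1]→L[ℝ] ℝ} {Φ : TangentSpace (𝓡 6) x [⋀^Fin 2]→L[ℝ] ℝ}
    (hΦ : Φ = wedge γ (η.form i₀ x) + r • wedge (η.ω₁ x) (η.ω₂ x) + s • wedge (η.ω₃ x) (η.ω₄ x)) :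
    η.Paired i₀ x Φ := by
  intro a b ha hb hab
  rw [hΦ]
  simp only [ContinuousAlternatingMap.add_apply, ContinuousAlternatingMap.smul_apply, smul_eq_mul,
    wedge_apply_vec hx]
  rw [wedge_apply]
  simp only [Matrix.cons_val_zero, Matrix.cons_val_one, η.dual x hx, if_neg ha.symm, if_neg hb.symm]
  revert hab
  fin_cases a <;> fin_cases b <;> simp [partner]

theorem apply_ne_of_structure {x : B} (hx : x ∈ U) {i₀ : Fin 6} (hi : i₀ < 2) {r s : ℝ}
    (hr : r ≠ 0) (hs : s ≠ 0)
    {γ : TangentSpace (𝓡 6) x [⋀^Fin 1]→L[ℝ] ℝ} {Φ : TangentSpace (𝓡 6) x [⋀^Fin 2]→L[ℝ] ℝ}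
    (hΦ : Φ = wedge γ (η.form i₀ x) + r • wedge (η.ω₁ x) (η.ω₂ x) + s • wedge (η.ω₃ x) (η.ω₄ x))
    {a : Fin 6} (ha : 2 ≤ a) : Φ ![η.vec (partner a) x, η.vec a x] ≠ 0 := by
  rw [hΦ]
  simp only [ContinuousAlternatingMap.add_apply, ContinuousAlternatingMap.smul_apply, smul_eq_mul,
    wedge_apply_vec hx]
  rw [wedge_apply]
  have h1 : i₀ ≠ a := (hi.trans_le ha).ne
  have h2 : i₀ ≠ partner a := (hi.trans_le (two_le_partner ha)).ne
  simp only [Matrix.cons_val_zero, Matrix.cons_val_one, η.dual x hx, if_neg h1, if_neg h2]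
  revert ha
  fin_cases a <;> simp [partner, hr, hs]

theorem IsZeroAdapted.isAdaptedTo₁ (hB : IsBacklundTransformation I₁ I₂ ι)
    (hη : η.IsZeroAdapted I₁ I₂ ι) : η.IsAdaptedTo I₁ (proj₁ ι) 0 1 where
  index := Or.inl ⟨rfl, rfl⟩
  mongeAmpere := hB.mongeAmpere₁
  smooth_map := contMDiff_fst.comp hB.embedding.contMDiff
  submersion := hB.submersion₁
  contact := hη.contact₁
  mixed x hx _ hΦ _ _ hab := hη.apply_mixed hx (Submodule.mem_sup_left hΦ) hab
  paired_d x hx := by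
    obtain ⟨A₁, A₂, h⟩ := hη.structure_eq
    obtain ⟨-, -, -, ⟨γ, hγ⟩, -⟩ := h x hx
    exact paired_of_structure hx (i₀ := 0) (r := A₁ x) (s := 1) (γ := γ) (by rw [hγ, one_smul])
  d_ne x hx a ha := by
    obtain ⟨A₁, A₂, h⟩ := hη.structure_eq
    obtain ⟨hA, -, -, ⟨γ, hγ⟩, -⟩ := h x hx
    exact apply_ne_of_structure hx (i₀ := 0) (s := 1) (γ := γ) (by decide) hA one_ne_zero (by rw [hγ, one_smul]) ha

theorem IsZeroAdapted.isAdaptedTo₂ (hB : IsBacklundTransformation I₁ I₂ ι)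
    (hη : η.IsZeroAdapted I₁ I₂ ι) : η.IsAdaptedTo I₂ (proj₂ ι) 1 0 where
  index := Or.inr ⟨rfl, rfl⟩
  mongeAmpere := hB.mongeAmpere₂
  smooth_map := contMDiff_snd.comp hB.embedding.contMDiff
  submersion := hB.submersion₂
  contact := hη.contact₂
  mixed x hx _ hΦ _ _ hab := hη.apply_mixed hx (Submodule.mem_sup_right hΦ) hab
  paired_d x hx := by
    obtain ⟨A₁, A₂, h⟩ := hη.structure_eq
    obtain ⟨-, -, -, -, ⟨γ, hγ⟩⟩ := h x hx
    exact paired_of_structure hx (i₀ := 1) (r := 1) (s := A₂ x) (γ := γ) (by rw [hγ, one_smul])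
  d_ne x hx a ha := by
    obtain ⟨A₁, A₂, h⟩ := hη.structure_eq
    obtain ⟨-, hA, -, -, ⟨γ, hγ⟩⟩ := h x hx
    exact apply_ne_of_structure hx (i₀ := 1) (r := 1) (γ := γ) (by decide) one_ne_zero hA (by rw [hγ, one_smul]) ha

theorem coeff_swap (i j k : Fin 6) (x : B) : η.coeff i j k x = - η.coeff i k j x :=
  two_form_swap _ _ _

theorem coeff_self (i j : Fin 6) (x : B) : η.coeff i j j x = 0 := two_form_self _ _

/-- If the coefficients of `θ₁ ∧ θ₂` vanish for one pair of forms on an open set, then they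
vanish for the other pair, by `d² = 0`. -/
theorem coeff_zero_one_eq_zero [IsManifold (𝓡 6) ∞ B] (hU : IsOpen U)
    (h₀ : ∀ x ∈ U, ∀ a b, Mixed a b → η.coeff a 0 b x = 0)
    (h₁ : ∀ x ∈ U, ∀ a b, Mixed a b → η.coeff a 1 b x = 0)
    {V : Set B} (hV : IsOpen V) (hVU : V ⊆ U) {k d : Fin 6} (hkd : Mixed k d)
    (hk : ∀ x ∈ V, η.coeff k 0 1 x = 0) (hk' : ∀ x ∈ V, η.coeff (partner k) 0 1 x = 0)
    {x : B} (hx : x ∈ V) (hne : η.coeff k (partner d) d x ≠ 0) :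
    η.coeff (partner d) 0 1 x = 0 := by
  have hmd : Mixed k (partner d) := hkd.symm.partner_left.symm
  have hxU := hVU hx
  -- The 2-form is dω^k itself. Its entries on (e₀, e₁), (e₀, e_d), (e₁, e_d) vanish near `x`, the
  -- first by the assumption on `V`, the others by projectability.
  have key := η.d_of_vanish₂ hU hxU (a := 0) (b := 1) (d := d)
    (((η.smooth k).d hU).diffAt hxU)
    (by filter_upwards [hU.eventually_mem hxU] with y hy using h₁ y hy k d hkd)
    (by filter_upwards [hU.eventually_mem hxU] with y hy using h₀ y hy k d hkd)
    (by filter_upwards [hV.eventually_mem hx] with y hy using hk y hy)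
  rw [(η.smooth k).d_d hU hxU] at key
  replace key : 0 = ∑ i, (η.coeff i 0 1 x * η.coeff k i d x + η.coeff i 1 d x * η.coeff k i 0 x
    + η.coeff i d 0 x * η.coeff k i 1 x) := key
  -- Only the summand of `partner d` survives: it is the sought coefficient times `η.coeff k
  -- (partner d) d x`.
  rw [Finset.sum_eq_single (partner d)] at key
  · rw [η.coeff_swap k (partner d) 0, h₀ x hxU k _ hmd, η.coeff_swap k (partner d) 1,
      h₁ x hxU k _ hmd] at key
    simp only [neg_zero, mul_zero, add_zero] at key
    exact (mul_eq_zero.1 key.symm).resolve_right hne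
  · intro i _ hi
    by_cases hi2 : 2 ≤ i
    · rcases hkd.cover i hi2 with rfl | rfl | rfl | rfl
      · rw [hk x hx, h₁ x hxU _ _ hkd, η.coeff_swap i d 0, h₀ x hxU _ _ hkd]; ring
      · rw [hk' x hx, h₁ x hxU _ _ hkd.partner_left, η.coeff_swap _ d 0,
          h₀ x hxU _ _ hkd.partner_left]; ring
      · rw [η.coeff_self, η.coeff_swap k i 0, h₀ x hxU _ _ hkd, η.coeff_swap k i 1,
          h₁ x hxU _ _ hkd]; ring
      · exact absurd rfl hi
    · have : i = 0 ∨ i = 1 := (by decide : ∀ i : Fin 6, ¬2 ≤ i → i = 0 ∨ i = 1) i hi2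
      rcases this with rfl | rfl
      · rw [h₀ x hxU _ _ hkd, η.coeff_self, hk x hx]; ring
      · rw [h₁ x hxU _ _ hkd, η.coeff_self, η.coeff_swap k 1 0, hk x hx]; ring
  · simp

theorem B₁₂_eq_zero_iff {x : B} : η.B₁₂ x = 0 ↔ η.coeff 2 0 1 x = 0 ∧ η.coeff 3 0 1 x = 0 := by
  simp [B₁₂, funext_iff, Fin.forall_fin_two]

theorem B₃₄_eq_zero_iff {x : B} : η.B₃₄ x = 0 ↔ η.coeff 4 0 1 x = 0 ∧ η.coeff 5 0 1 x = 0 := by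
  simp [B₃₄, funext_iff, Fin.forall_fin_two]

variable [IsManifold (𝓡 6) ∞ B] [IsManifold (𝓡 5) ∞ M₁] [IsManifold (𝓡 5) ∞ M₂]

theorem IsOneAdapted.vanish_iff (hB : IsBacklundTransformation I₁ I₂ ι) (hU : IsOpen U)
    (hη : η.IsOneAdapted I₁ I₂ ι) {V : Set B} (hVU : V ⊆ U) (hV : IsOpen V) :
    (∀ x ∈ V, η.B₁₂ x = 0) ↔ ∀ x ∈ V, η.B₃₄ x = 0 := by
  have h₁ : ∀ x ∈ U, ∀ a b, Mixed a b → η.coeff a 1 b x = 0 := fun x hx a b =>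
    (hη.isAdaptedTo₁ hB).coeff_eq_zero hU hx
  have h₀ : ∀ x ∈ U, ∀ a b, Mixed a b → η.coeff a 0 b x = 0 := fun x hx a b =>
    (hη.isAdaptedTo₂ hB).coeff_eq_zero hU hx
  have hC : ∀ x ∈ U, η.coeff 3 4 5 x = 1 := fun x hx => congrFun (hη.C₁₂_eq x hx) 1
  have hC' : ∀ x ∈ U, η.coeff 5 2 3 x = 1 := fun x hx => congrFun (hη.C₃₄_eq x hx) 1
  simp only [B₁₂_eq_zero_iff, B₃₄_eq_zero_iff]
  constructor
  · intro h x hx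
    refine ⟨?_, ?_⟩
    · refine coeff_zero_one_eq_zero hU h₀ h₁ hV hVU (k := 3) (d := 5) (by decide)
        (fun y hy => (h y hy).2) (fun y hy => (h y hy).1) hx ?_
      exact (hC x (hVU hx)).trans_ne one_ne_zero
    · refine coeff_zero_one_eq_zero hU h₀ h₁ hV hVU (k := 3) (d := 4) (by decide)
        (fun y hy => (h y hy).2) (fun y hy => (h y hy).1) hx ?_
      rw [coeff_swap, neg_ne_zero]
      exact (hC x (hVU hx)).trans_ne one_ne_zero
  · intro h x hx
    refine ⟨?_, ?_⟩
    · refine coeff_zero_one_eq_zero hU h₀ h₁ hV hVU (k := 5) (d := 3) (by decide)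
        (fun y hy => (h y hy).2) (fun y hy => (h y hy).1) hx ?_
      exact (hC' x (hVU hx)).trans_ne one_ne_zero
    · refine coeff_zero_one_eq_zero hU h₀ h₁ hV hVU (k := 5) (d := 2) (by decide)
        (fun y hy => (h y hy).2) (fun y hy => (h y hy).1) hx ?_
      rw [coeff_swap, neg_ne_zero]
      exact (hC' x (hVU hx)).trans_ne one_ne_zero

end Coframing
end Structure
-- Symmetries and the dichotomy in the homogeneous case.
section Homogeneous

open Filter

/-- Two properties, equivalent on open sets and with open negations, that a transitive action
preserves up to exchange either hold both everywhere or fail both everywhere. -/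
theorem all_or_none_of_transitive {X : Type*} [TopologicalSpace X] {U : Set X} (hU : IsOpen U)
    {a b : X → Prop} (ha : ∀ x ∈ U, ¬a x → ∀ᶠ y in 𝓝 x, ¬a y)
    (hb : ∀ x ∈ U, ¬b x → ∀ᶠ y in 𝓝 x, ¬b y)
    (hV : ∀ V ⊆ U, IsOpen V → ((∀ x ∈ V, a x) ↔ ∀ x ∈ V, b x))
    (h : ∀ p ∈ U, ∀ q ∈ U, ((a p → a q) ∧ (b p → b q)) ∨ ((a p → b q) ∧ (b p → a q))) :
    (∀ x ∈ U, a x ∧ b x) ∨ ∀ x ∈ U, ¬a x ∧ ¬b x := by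
  have key : ∀ {a b : X → Prop}, (∀ x ∈ U, ¬b x → ∀ᶠ y in 𝓝 x, ¬b y) →
      (∀ V ⊆ U, IsOpen V → (∀ x ∈ V, a x) → ∀ x ∈ V, b x) →
      (∀ p ∈ U, ∀ q ∈ U, ((a p → a q) ∧ (b p → b q)) ∨ ((a p → b q) ∧ (b p → a q))) →
      ∀ x ∈ U, a x → b x := by
    intro a b hb hV h x hx hax
    by_contra hbx
    -- On `V` the property `b` fails throughout, so a symmetry from `x` into `V` cannot carry `a` to
    -- `b`; hence `a` holds on all of `V`, which forces `b` at `x`.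
    obtain ⟨V, hVs, hVo, hxV⟩ := eventually_nhds_iff.1 ((hb x hx hbx).and (hU.eventually_mem hx))
    refine hbx (hV V (fun y hy => (hVs y hy).2) hVo (fun y hy => ?_) x hxV)
    rcases h x hx y (hVs y hy).2 with h1 | h1
    · exact h1.1 hax
    · exact absurd (h1.1 hax) (hVs y hy).1
  have h1 : ∀ x ∈ U, a x → b x := key hb (fun V h1 h2 => (hV V h1 h2).1) h
  have h2 : ∀ x ∈ U, b x → a x := key ha (fun V h1 h2 => (hV V h1 h2).2) fun p hp q hq =>
    (h p hp q hq).imp And.symm And.symm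
  by_cases hex : ∃ p ∈ U, a p
  · obtain ⟨p, hp, hap⟩ := hex
    refine Or.inl fun q hq => ?_
    rcases h p hp q hq with h3 | h3
    · exact ⟨h3.1 hap, h3.2 (h1 p hp hap)⟩
    · exact ⟨h3.2 (h1 p hp hap), h3.1 hap⟩
  · refine Or.inr fun q hq => ⟨fun h3 => hex ⟨q, hq, h3⟩, fun h3 => hex ⟨q, hq, h2 q hq h3⟩⟩

/-! ### Linear algebra of 6×6 matrices with vanishing minors. -/

section Matrix

variable {P : Fin 6 → Fin 6 → ℝ}

/-- The pairing of the indices `0, 1` and `2, 3` and `4, 5`. -/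
def mate : Fin 6 → Fin 6 := ![1, 0, 3, 2, 5, 4]

/-- Two independent rows whose minors vanish outside the columns `a, mate a` are supported in one
such pair of columns. -/
theorem exists_support_pair (hP : ∀ c : Fin 6 → ℝ, (∀ j, ∑ i, c i * P i j = 0) → c = 0)
    {k l : Fin 6} (hkl : k ≠ l)
    (hm : ∀ a b, b ≠ mate a → P k a * P l b - P k b * P l a = 0) :
    ∃ a, P k a * P l (mate a) - P k (mate a) * P l a ≠ 0 ∧
      ∀ j, j ≠ a → j ≠ mate a → P k j = 0 ∧ P l j = 0 := by
  have h1 : ∃ a, P k a * P l (mate a) - P k (mate a) * P l a ≠ 0 := by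
    by_contra! hall
    have hmin : ∀ a b, P k a * P l b - P k b * P l a = 0 := by
      intro a b
      by_cases hb : b = mate a
      · rw [hb]; exact hall a
      · exact hm a b hb
    have hl : ∀ b, P l b = 0 := by
      intro b
      -- With all minors zero this combination of the two rows vanishes, so `P l b = 0` for every
      -- `b`; a zero row contradicts independence.
      have h := congrFun (hP (Pi.single k (P l b) - Pi.single l (P k b)) fun j => by
        simp only [Pi.sub_apply, sub_mul, Finset.sum_sub_distrib, Pi.single_apply, ite_mul,
          zero_mul, Finset.sum_ite_eq', Finset.mem_univ, if_true]
        linarith [hmin j b]) k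
      simpa [Pi.single_apply, hkl] using h
    have h := congrFun (hP (Pi.single l 1) fun j => by
      simp [Pi.single_apply, hl]) l
    simp at h
  obtain ⟨a, ha⟩ := h1
  have hinv : ∀ c, mate (mate c) = c := by decide
  refine ⟨a, ha, fun j hja hjm => ⟨?_, ?_⟩⟩
  all_goals
    have e1 := hm a j hjm
    have e2 := hm (mate a) j (by rw [hinv]; exact hja)
    refine (mul_eq_zero.1 ?_).resolve_right ha
  · linear_combination P k (mate a) * e1 - P k a * e2
  · linear_combination P l (mate a) * e1 - P l a * e2

theorem diag_ne_zero (hP : ∀ c : Fin 6 → ℝ, (∀ j, ∑ i, c i * P i j = 0) → c = 0) {i : Fin 6}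
    (hi : ∀ j, j ≠ i → P i j = 0) : P i i ≠ 0 := by
  intro h0
  have h := congrFun (hP (Pi.single i 1) fun j => by
    by_cases hj : j = i
    · simp [Pi.single_apply, hj, h0]
    · simp [Pi.single_apply, hi j hj]) i
  simp at h

/-- A row supported in `{0, 1}` is a combination of the rows `0` and `1`. -/
theorem two_le_of_support (hP : ∀ c : Fin 6 → ℝ, (∀ j, ∑ i, c i * P i j = 0) → c = 0)
    (h0 : ∀ j, j ≠ 0 → P 0 j = 0) (h1 : ∀ j, j ≠ 1 → P 1 j = 0) {k : Fin 6} (hk : 2 ≤ k)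
    {a : Fin 6} (hs : ∀ j, j ≠ a → j ≠ mate a → P k j = 0) : 2 ≤ a := by
  by_contra ha
  have hmate : ∀ a : Fin 6, ¬2 ≤ a → ¬2 ≤ mate a := by decide
  have hz : ∀ j : Fin 6, 2 ≤ j → P k j = 0 := fun j hj => hs j
    (by rintro rfl; exact ha hj)
    (by rintro rfl; exact hmate a ha hj)
  have h00 : P 0 0 ≠ 0 := diag_ne_zero hP h0
  have h11 : P 1 1 ≠ 0 := diag_ne_zero hP h1
  have hk0 : k ≠ 0 := by rintro rfl; revert hk; decide
  have hk1 : k ≠ 1 := by rintro rfl; revert hk; decide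
  have h := congrFun (hP (Pi.single k 1 - Pi.single 0 (P k 0 / P 0 0)
    - Pi.single 1 (P k 1 / P 1 1)) fun j => by
      simp only [Pi.sub_apply, sub_mul, Finset.sum_sub_distrib, Pi.single_apply, ite_mul,
        zero_mul, Finset.sum_ite_eq', Finset.mem_univ, if_true, one_mul]
      rcases (by decide : ∀ j : Fin 6, j = 0 ∨ j = 1 ∨ 2 ≤ j ∧ j ≠ 0 ∧ j ≠ 1) j with
        rfl | rfl | ⟨hj, hj0, hj1⟩
      · rw [h1 0 (by decide), div_mul_cancel₀ _ h00]; ring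
      · rw [h0 1 (by decide), div_mul_cancel₀ _ h11]; ring
      · rw [hz j hj, h0 j hj0, h1 j hj1]; ring) k
  simp [hk0, hk1] at h

/-- Three rows supported in two columns are dependent. -/
theorem not_support_of_three (hP : ∀ c : Fin 6 → ℝ, (∀ j, ∑ i, c i * P i j = 0) → c = 0)
    {k l m : Fin 6} (hkm : k ≠ m) (hlm : l ≠ m) {a b : Fin 6}
    (hne : P k a * P l b - P k b * P l a ≠ 0)
    (hk : ∀ j, j ≠ a → j ≠ b → P k j = 0) (hl : ∀ j, j ≠ a → j ≠ b → P l j = 0)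
    (hm : ∀ j, j ≠ a → j ≠ b → P m j = 0) : False := by
  -- The coefficients are the 2×2 minors in columns `a`, `b`: the linear relation among three
  -- vectors of a plane.
  have h := congrFun (hP (Pi.single m (P k a * P l b - P k b * P l a)
    - Pi.single k (P m a * P l b - P m b * P l a)
    - Pi.single l (P k a * P m b - P k b * P m a)) fun j => by
      simp only [Pi.sub_apply, sub_mul, Finset.sum_sub_distrib, Pi.single_apply, ite_mul,
        zero_mul, Finset.sum_ite_eq', Finset.mem_univ, if_true]
      by_cases hja : j = a
      · rw [hja]; ring
      by_cases hjb : j = b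
      · rw [hjb]; ring
      rw [hk j hja hjb, hl j hja hjb, hm j hja hjb]; ring) m
  simp [hkm.symm, hlm.symm] at h
  exact hne h

/-- The block structure of a matrix that preserves the pairs `{2, 3}` and `{4, 5}` up to
exchange. -/
theorem block_or_swap (hP : ∀ c : Fin 6 → ℝ, (∀ j, ∑ i, c i * P i j = 0) → c = 0)
    (h0 : ∀ j, j ≠ 0 → P 0 j = 0) (h1 : ∀ j, j ≠ 1 → P 1 j = 0)
    (hm : ∀ a b, b ≠ mate a → P 2 a * P 3 b - P 2 b * P 3 a = 0)
    (hm' : ∀ a b, b ≠ mate a → P 4 a * P 5 b - P 4 b * P 5 a = 0) :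
    ((∀ j, j ≠ 2 → j ≠ 3 → P 2 j = 0 ∧ P 3 j = 0) ∧
      ∀ j, j ≠ 4 → j ≠ 5 → P 4 j = 0 ∧ P 5 j = 0) ∨
    ((∀ j, j ≠ 4 → j ≠ 5 → P 2 j = 0 ∧ P 3 j = 0) ∧
      ∀ j, j ≠ 2 → j ≠ 3 → P 4 j = 0 ∧ P 5 j = 0) := by
  obtain ⟨a, ha, hsa⟩ := exists_support_pair hP (by decide) hm
  obtain ⟨b, hb, hsb⟩ := exists_support_pair hP (by decide) hm'
  have ha2 := two_le_of_support hP h0 h1 (k := 2) (by decide) fun j h h' => (hsa j h h').1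
  have hb2 := two_le_of_support hP h0 h1 (k := 4) (by decide) fun j h h' => (hsb j h h').1
  have hcase : ∀ a b : Fin 6, 2 ≤ a → 2 ≤ b → (b = a ∨ b = mate a) ∨
      ((a = 2 ∨ a = 3) ∧ (b = 4 ∨ b = 5)) ∨ ((a = 4 ∨ a = 5) ∧ (b = 2 ∨ b = 3)) := by decide
  have h2 : ∀ {p : Fin 6 → Prop} {c : Fin 6}, (c = 2 ∨ c = 3) → (∀ j, j ≠ c → j ≠ mate c → p j) →
      ∀ j, j ≠ 2 → j ≠ 3 → p j := by
    rintro p c (rfl | rfl) h j hj hj'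
    · exact h j hj hj'
    · exact h j hj' hj
  have h4 : ∀ {p : Fin 6 → Prop} {c : Fin 6}, (c = 4 ∨ c = 5) → (∀ j, j ≠ c → j ≠ mate c → p j) →
      ∀ j, j ≠ 4 → j ≠ 5 → p j := by
    rintro p c (rfl | rfl) h j hj hj'
    · exact h j hj hj'
    · exact h j hj' hj
  rcases hcase a b ha2 hb2 with hab | ⟨hc, hd⟩ | ⟨hc, hd⟩
  · exfalso
    refine not_support_of_three hP (k := 2) (l := 3) (m := 4) (by decide) (by decide) ha
      (fun j h h' => (hsa j h h').1) (fun j h h' => (hsa j h h').2) fun j h h' => ?_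
    have hinv : ∀ c, mate (mate c) = c := by decide
    rcases hab with rfl | rfl
    · exact (hsb j h h').1
    · exact (hsb j h' (by rw [hinv]; exact h)).1
  · exact Or.inl ⟨h2 hc hsa, h4 hd hsb⟩
  · exact Or.inr ⟨h4 hc hsa, h2 hd hsb⟩

end Matrix

/-! ### The action of a symmetry on the coframing. -/

namespace Coframing

variable {B : Type*} [TopologicalSpace B] [ChartedSpace (EuclideanSpace ℝ (Fin 6)) B]
  {U : Set B} {η : Coframing U}

/-- The matrix of the derivative of `φ` at `x` with respect to the coframing. -/
noncomputable def transition (η : Coframing U) (φ : B → B) (x : B) (i j : Fin 6) : ℝ :=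
  η.form i (φ x) ![mfderiv (𝓡 6) (𝓡 6) φ x (η.vec j x)]

/-- A relation between the rows is a covector at φ(x) that kills the image of the derivative, which
is the whole tangent space. -/
theorem transition_independent {φ : B → B} {x : B} (hx : x ∈ U) (hx' : φ x ∈ U)
    (hφ : Function.Surjective (mfderiv (𝓡 6) (𝓡 6) φ x)) {c : Fin 6 → ℝ}
    (hc : ∀ j, ∑ i, c i * η.transition φ x i j = 0) : c = 0 := by
  funext k
  obtain ⟨w, hw⟩ := hφ (η.vec k (φ x))
  have h : ∀ v, ∑ i, c i * η.form i (φ x) ![mfderiv (𝓡 6) (𝓡 6) φ x v] = 0 := by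
    intro v
    have hv : ∀ i, η.form i (φ x) ![mfderiv (𝓡 6) (𝓡 6) φ x v] =
        ∑ j, η.form j x ![v] * η.transition φ x i j := by
      intro i
      conv_lhs => rw [η.expand hx v]
      rw [← lin_apply, map_sum, map_sum]
      refine Finset.sum_congr rfl fun j _ => ?_
      rw [map_smul, map_smul]
      rfl
    simp only [hv, Finset.mul_sum]
    rw [Finset.sum_comm]
    refine Finset.sum_eq_zero fun j _ => ?_
    have := congrArg (fun r => η.form j x ![v] * r) (hc j)
    rw [mul_zero, Finset.mul_sum] at this
    rw [← this]
    exact Finset.sum_congr rfl fun i _ => by ring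
  have h2 := h w
  simp only [hw, η.dual _ hx', mul_ite, mul_one, mul_zero, Finset.sum_ite_eq', Finset.mem_univ,
    if_true] at h2
  exact h2

variable {N : Type*} [TopologicalSpace N] [ChartedSpace (EuclideanSpace ℝ (Fin 5)) N]
  {I : IdealField 5 N} {π : B → N} {i₀ i₁ : Fin 6}

theorem IsAdaptedTo.transition_contact (hη : η.IsAdaptedTo I π i₀ i₁) {φ : B → B}
    (hφ : IdealField.pullback φ (IdealField.pullback (n := 6) π I) =
      IdealField.pullback (n := 6) π I) {x : B} (hx : x ∈ U) (hx' : φ x ∈ U) {j : Fin 6}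
    (hj : j ≠ i₀) : η.transition φ x i₀ j = 0 := by
  have hmem : (η.form i₀ (φ x)).compContinuousLinearMap (mfderiv (𝓡 6) (𝓡 6) φ x) ∈
      (IdealField.pullback φ (IdealField.pullback (n := 6) π I) x).deg1 := by
    refine Submodule.subset_span ⟨_, ?_, rfl⟩
    rw [hη.contact _ hx']
    exact Submodule.mem_span_singleton_self _
  rw [hφ, hη.contact x hx] at hmem
  obtain ⟨c, hc⟩ := Submodule.mem_span_singleton.1 hmem
  have h := Form.pullback_apply₁ (n := 6) φ (η.form i₀) x (η.vec j x)
  rw [transition, ← h]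
  refine (congrArg (fun α => α ![η.vec j x]) hc).symm.trans ?_
  show (c • η.form i₀ x) ![η.vec j x] = 0
  rw [ContinuousAlternatingMap.smul_apply, η.dual x hx, if_neg hj.symm, smul_zero]

variable [IsManifold (𝓡 6) ∞ B] [IsManifold (𝓡 5) ∞ N]

/-- ω^k ∧ ω^{partner k} belongs to the ideal at φ(x), so its pullback belongs to the ideal at `x`
and is paired there. Its entries are these minors. -/
theorem IsAdaptedTo.transition_minor (hη : η.IsAdaptedTo I π i₀ i₁) (hU : IsOpen U) {φ : B → B}
    (hφ : IdealField.pullback φ (IdealField.pullback (n := 6) π I) =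
      IdealField.pullback (n := 6) π I) {x : B} (hx : x ∈ U) (hx' : φ x ∈ U) {k a b : Fin 6} (ha : a ≠ i₀) (hb : b ≠ i₀) (hab : b ≠ partner a) :
    η.transition φ x k a * η.transition φ x (partner k) b -
      η.transition φ x k b * η.transition φ x (partner k) a = 0 := by
  have hw : wedge (η.form k (φ x)) (η.form (partner k) (φ x)) ∈
      (IdealField.pullback (n := 6) π I (φ x)).deg2 := by
    rw [hη.mem_deg2_iff hU hx']
    intro a b _ _ hab
    rw [wedge_apply_vec hx']
    have h1 : ¬(k = a ∧ partner k = b) := by rintro ⟨rfl, rfl⟩; exact hab rfl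
    have h2 : ¬(k = b ∧ partner k = a) := by
      rintro ⟨rfl, rfl⟩; rw [partner_partner] at hab; exact hab rfl
    rw [ite_zero_mul_ite_zero, ite_zero_mul_ite_zero, if_neg h1, if_neg h2, sub_zero]
  have hmem : (wedge (η.form k (φ x)) (η.form (partner k) (φ x))).compContinuousLinearMap
      (mfderiv (𝓡 6) (𝓡 6) φ x) ∈
      (IdealField.pullback φ (IdealField.pullback (n := 6) π I) x).deg2 :=
    Submodule.subset_span (Or.inr ⟨_, hw, rfl⟩)
  rw [hφ, hη.mem_deg2_iff hU hx] at hmem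
  have h := hmem a b ha hb hab
  have h2 := Form.pullback_apply₂ (n := 6) φ
    (fun y => wedge (η.form k y) (η.form (partner k) y)) x (η.vec a x) (η.vec b x)
  rw [wedge_apply] at h2
  exact h2.symm.trans h

variable {M₁ : Type*} [TopologicalSpace M₁] [ChartedSpace (EuclideanSpace ℝ (Fin 5)) M₁]
  {M₂ : Type*} [TopologicalSpace M₂] [ChartedSpace (EuclideanSpace ℝ (Fin 5)) M₂]
  [IsManifold (𝓡 5) ∞ M₁] [IsManifold (𝓡 5) ∞ M₂]
  {I₁ : IdealField 5 M₁} {I₂ : IdealField 5 M₂} {ι : B → M₁ × M₂}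

theorem IsZeroAdapted.transition_block (hB : IsBacklundTransformation I₁ I₂ ι) (hU : IsOpen U)
    (hη : η.IsZeroAdapted I₁ I₂ ι) {φ : B ≃ₘ^∞⟮𝓡 6, 𝓡 6⟯ B} (hφ : IsSymmetry I₁ I₂ ι φ) {x : B}
    (hx : x ∈ U) (hx' : φ x ∈ U) :
    ((∀ j, j ≠ 0 → η.transition φ x 0 j = 0) ∧ ∀ j, j ≠ 1 → η.transition φ x 1 j = 0) ∧
    (((∀ j, j ≠ 2 → j ≠ 3 → η.transition φ x 2 j = 0 ∧ η.transition φ x 3 j = 0) ∧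
      ∀ j, j ≠ 4 → j ≠ 5 → η.transition φ x 4 j = 0 ∧ η.transition φ x 5 j = 0) ∨
    ((∀ j, j ≠ 4 → j ≠ 5 → η.transition φ x 2 j = 0 ∧ η.transition φ x 3 j = 0) ∧
      ∀ j, j ≠ 2 → j ≠ 3 → η.transition φ x 4 j = 0 ∧ η.transition φ x 5 j = 0)) := by
  have h0 : ∀ j, j ≠ 0 → η.transition φ x 0 j = 0 := fun j hj =>
    (hη.isAdaptedTo₁ hB).transition_contact hφ.1 hx hx' hj
  have h1 : ∀ j, j ≠ 1 → η.transition φ x 1 j = 0 := fun j hj =>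
    (hη.isAdaptedTo₂ hB).transition_contact hφ.2 hx hx' hj
  have hm : ∀ k a b, b ≠ mate a →
      η.transition φ x k a * η.transition φ x (partner k) b -
        η.transition φ x k b * η.transition φ x (partner k) a = 0 := by
    intro k a b hab
    -- The first ideal controls columns other than 0, the second those other than 1. Together they
    -- miss only the columns {0, 1} and the two ω-pairs.
    rcases (by decide : ∀ a b : Fin 6, b ≠ mate a → b = a ∨
      (a ≠ 0 ∧ b ≠ 0 ∧ b ≠ partner a) ∨ (a ≠ 1 ∧ b ≠ 1 ∧ b ≠ partner a)) a b hab with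
      rfl | ⟨ha, hb, h⟩ | ⟨ha, hb, h⟩
    · ring
    · exact (hη.isAdaptedTo₁ hB).transition_minor hU hφ.1 hx hx' ha hb h
    · exact (hη.isAdaptedTo₂ hB).transition_minor hU hφ.2 hx hx' ha hb h
  have hsurj : Function.Surjective (mfderiv (𝓡 6) (𝓡 6) φ x) :=
    (φ.mfderivToContinuousLinearEquiv (by simp) x).surjective
  exact ⟨⟨h0, h1⟩, block_or_swap (fun c hc => transition_independent hx hx' hsurj hc) h0 h1
    (hm 2) (hm 4)⟩

/-- How the coefficients of `θ₁ ∧ θ₂` transform under a symmetry. -/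
theorem IsZeroAdapted.coeff_transform (hB : IsBacklundTransformation I₁ I₂ ι) (hU : IsOpen U)
    (hη : η.IsZeroAdapted I₁ I₂ ι) {φ : B ≃ₘ^∞⟮𝓡 6, 𝓡 6⟯ B} (hφ : IsSymmetry I₁ I₂ ι φ) {x : B}
    (hx : x ∈ U) (hx' : φ x ∈ U) {i : Fin 6} (hi : 2 ≤ i) :
    η.transition φ x 0 0 * η.transition φ x 1 1 * η.coeff i 0 1 (φ x) =
      ∑ k, η.transition φ x i k * η.coeff k 0 1 x := by
  -- The blocks make φ^*ωⁱ vanish on e₀ and e₁ near `x`, and make the derivative of φ scale these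
  -- two vectors. Evaluating φ^*dωⁱ = d(φ^*ωⁱ) on them gives the formula.
  have hrow : ∀ y ∈ U, φ y ∈ U → ∀ l, l < 2 → ∀ i, i ≠ l → η.transition φ y i l = 0 := by
    intro y hy hy' l hl i hil
    obtain ⟨⟨h0, h1⟩, h⟩ := hη.transition_block hB hU hφ hy hy'
    have e2 : l ≠ 2 := by rintro rfl; exact absurd hl (by decide)
    have e3 : l ≠ 3 := by rintro rfl; exact absurd hl (by decide)
    have e4 : l ≠ 4 := by rintro rfl; exact absurd hl (by decide)
    have e5 : l ≠ 5 := by rintro rfl; exact absurd hl (by decide)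
    rcases h with ⟨ha, hb⟩ | ⟨ha, hb⟩ <;> fin_cases i
    all_goals first
      | exact h0 l hil.symm
      | exact h1 l hil.symm
      | exact (ha l e2 e3).1
      | exact (ha l e2 e3).2
      | exact (ha l e4 e5).1
      | exact (ha l e4 e5).2
      | exact (hb l e2 e3).1
      | exact (hb l e2 e3).2
      | exact (hb l e4 e5).1
      | exact (hb l e4 e5).2
  have hev : ∀ᶠ y in 𝓝 x, y ∈ U ∧ φ y ∈ U := (hU.eventually_mem hx).and
    ((φ.contMDiff.continuous.tendsto x).eventually (hU.mem_nhds hx'))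
  have hsm : ContMDiffAt (𝓡 6) (𝓡 6) 2 φ x := (φ.contMDiff x).of_le ENat.LEInfty.out
  have hi0 : i ≠ 0 := by rintro rfl; revert hi; decide
  have hi1 : i ≠ 1 := by rintro rfl; revert hi; decide
  have hd := (η.smooth i).diffAt hx'
  have key := η.d_of_vanish₁ hU hx (a := 0) (b := 1) (Form.differentiableAt_coord_pullback hsm hd)
    (by
      filter_upwards [hev] with y hy
      rw [Form.pullback_apply₁]
      exact hrow y hy.1 hy.2 0 (by decide) i hi0)
    (by
      filter_upwards [hev] with y hy
      rw [Form.pullback_apply₁]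
      exact hrow y hy.1 hy.2 1 (by decide) i hi1)
  have hpush : ∀ l, l < 2 → mfderiv (𝓡 6) (𝓡 6) φ x (η.vec l x) =
      η.transition φ x l l • η.vec l (φ x) := by
    intro l hl
    rw [η.expand hx' (mfderiv (𝓡 6) (𝓡 6) φ x (η.vec l x)), Finset.sum_eq_single l]
    · rfl
    · intro k _ hk
      exact (congrArg (· • η.vec k (φ x)) (hrow x hx hx' l hl k hk)).trans (zero_smul _ _)
    · simp
  rw [Form.d_pullback hsm hd] at key
  have h2 := Form.pullback_apply₂ (n := 6) φ (η.form i).d x (η.vec 0 x) (η.vec 1 x)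
  rw [hpush 0 (by decide), hpush 1 (by decide), ← bilin_apply ((η.form i).d (φ x)), map_smul,
    map_smul, LinearMap.smul_apply] at h2
  refine Eq.trans ?_ (h2.symm.trans (key.trans ?_))
  · simp only [smul_eq_mul, bilin_apply]
    rw [coeff]; ring
  · exact Finset.sum_congr rfl fun k _ => by rw [Form.pullback_apply₁]; rfl

/-- By `coeff_transform`, each B_i at φ(x), up to the nonzero factor of the two diagonal entries, is
a combination of the B_k at `x` from a single pair. Which pair is decided by the block structure. -/
theorem IsZeroAdapted.vanish_transform (hB : IsBacklundTransformation I₁ I₂ ι) (hU : IsOpen U)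
    (hη : η.IsZeroAdapted I₁ I₂ ι) {φ : B ≃ₘ^∞⟮𝓡 6, 𝓡 6⟯ B} (hφ : IsSymmetry I₁ I₂ ι φ) {x : B}
    (hx : x ∈ U) (hx' : φ x ∈ U) :
    ((η.B₁₂ x = 0 → η.B₁₂ (φ x) = 0) ∧ (η.B₃₄ x = 0 → η.B₃₄ (φ x) = 0)) ∨
      ((η.B₁₂ x = 0 → η.B₃₄ (φ x) = 0) ∧ (η.B₃₄ x = 0 → η.B₁₂ (φ x) = 0)) := by
  obtain ⟨⟨h0, h1⟩, h⟩ := hη.transition_block hB hU hφ hx hx'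
  have hind : ∀ c : Fin 6 → ℝ, (∀ j, ∑ i, c i * η.transition φ x i j = 0) → c = 0 := fun c hc =>
    transition_independent hx hx' (φ.mfderivToContinuousLinearEquiv (by simp) x).surjective hc
  have hne := mul_ne_zero (diag_ne_zero hind h0) (diag_ne_zero hind h1)
  have key : ∀ i, 2 ≤ i → ∀ a b, (∀ j, j ≠ a → j ≠ b → η.transition φ x i j = 0) →
      η.coeff a 0 1 x = 0 ∧ η.coeff b 0 1 x = 0 → η.coeff i 0 1 (φ x) = 0 := by
    rintro i hi a b hs ⟨ha, hb⟩
    have e := hη.coeff_transform hB hU hφ hx hx' hi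
    rw [Finset.sum_eq_zero] at e
    · exact (mul_eq_zero.1 e).resolve_left hne
    · intro j _
      by_cases hja : j = a
      · rw [hja, ha, mul_zero]
      by_cases hjb : j = b
      · rw [hjb, hb, mul_zero]
      rw [hs j hja hjb, zero_mul]
  simp only [B₁₂_eq_zero_iff, B₃₄_eq_zero_iff]
  rcases h with ⟨ha, hb⟩ | ⟨ha, hb⟩
  · exact Or.inl
      ⟨fun h => ⟨key 2 (by decide) 2 3 (fun j u v => (ha j u v).1) h,
        key 3 (by decide) 2 3 (fun j u v => (ha j u v).2) h⟩,
      fun h => ⟨key 4 (by decide) 4 5 (fun j u v => (hb j u v).1) h,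
        key 5 (by decide) 4 5 (fun j u v => (hb j u v).2) h⟩⟩
  · exact Or.inr
      ⟨fun h => ⟨key 4 (by decide) 2 3 (fun j u v => (hb j u v).1) h,
        key 5 (by decide) 2 3 (fun j u v => (hb j u v).2) h⟩,
      fun h => ⟨key 2 (by decide) 4 5 (fun j u v => (ha j u v).1) h,
        key 3 (by decide) 4 5 (fun j u v => (ha j u v).2) h⟩⟩

theorem eventually_B₁₂_ne_zero (hU : IsOpen U) {x : B} (hx : x ∈ U) (h : η.B₁₂ x ≠ 0) :
    ∀ᶠ y in 𝓝 x, η.B₁₂ y ≠ 0 := by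
  refine ContinuousAt.eventually_ne (continuousAt_pi.2 fun i => ?_) h
  fin_cases i
  · exact η.continuousAt_coeff hU hx 2 0 1
  · exact η.continuousAt_coeff hU hx 3 0 1

theorem eventually_B₃₄_ne_zero (hU : IsOpen U) {x : B} (hx : x ∈ U) (h : η.B₃₄ x ≠ 0) :
    ∀ᶠ y in 𝓝 x, η.B₃₄ y ≠ 0 := by
  refine ContinuousAt.eventually_ne (continuousAt_pi.2 fun i => ?_) h
  fin_cases i
  · exact η.continuousAt_coeff hU hx 4 0 1
  · exact η.continuousAt_coeff hU hx 5 0 1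

end Coframing

end Homogeneous
end Backlund

theorem lemma5p1
    {M₁ : Type*} [TopologicalSpace M₁] [ChartedSpace (EuclideanSpace ℝ (Fin 5)) M₁]
    [IsManifold (𝓡 5) ∞ M₁]
    {M₂ : Type*} [TopologicalSpace M₂] [ChartedSpace (EuclideanSpace ℝ (Fin 5)) M₂]
    [IsManifold (𝓡 5) ∞ M₂]
    {B : Type*} [TopologicalSpace B] [ChartedSpace (EuclideanSpace ℝ (Fin 6)) B]
    [IsManifold (𝓡 6) ∞ B]
    (I₁ : IdealField 5 M₁) (I₂ : IdealField 5 M₂) (ι : B → M₁ × M₂)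
    (hB : IsBacklundTransformation I₁ I₂ ι)
    (U : Set B) (hU : IsOpen U) (η : Coframing U) (hη : η.IsOneAdapted I₁ I₂ ι) :
    (∀ V ⊆ U, IsOpen V → ((∀ x ∈ V, η.B₁₂ x = 0) ↔ (∀ x ∈ V, η.B₃₄ x = 0))) ∧
    (IsHomogeneous I₁ I₂ ι →
      (∀ x ∈ U, η.B₁₂ x = 0 ∧ η.B₃₄ x = 0) ∨ (∀ x ∈ U, η.B₁₂ x ≠ 0 ∧ η.B₃₄ x ≠ 0)) := by
  have hV : ∀ V ⊆ U, IsOpen V → ((∀ x ∈ V, η.B₁₂ x = 0) ↔ (∀ x ∈ V, η.B₃₄ x = 0)) :=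
    fun _ hVU hVo => hη.vanish_iff hB hU hVU hVo
  refine ⟨hV, fun hhom => ?_⟩
  refine all_or_none_of_transitive hU (fun x hx h => Coframing.eventually_B₁₂_ne_zero hU hx h)
    (fun x hx h => Coframing.eventually_B₃₄_ne_zero hU hx h) hV fun p hp q hq => ?_
  obtain ⟨φ, hφ, rfl⟩ := hhom p q
  exact hη.vanish_transform hB hU hφ hp hq
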